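/- Theorem 2.2. Let $g>0$, $\rho_+>\rho_->0$, $\mu_\pm>0$, $B\in\mathbb R\setminus\{0\}$, and put $[\rho]=\rho_+-\rho_-$. Let $\rho,\mu$ denote the functions on $(-1,0)\cup(0,1)$ equal to $\rho_-,\mu_-$ on $(-1,0)$ and to $\rho_+,\mu_+$ on $(0,1)$, and write $\llbracket f\rrbracket=f(0^+)-f(0^-)$. Define the critical magnetic number $|B|_c\ge 0$ and the critical frequency $|\xi|_{hc}^B\ge0$ by $$|B|_c^2=\sup_{0\ne\psi\in H_0^1((-1,1))}\frac{g[\rho]\psi(0)^2}{\int_{-1}^1|\psi'|^2\,dx_2},\qquad (|\xi|_{hc}^B)^2=\sup_{0\ne\psi\in H_0^1((-1,1))}\frac{g[\rho]\psi(0)^2-|B|^2\int_{-1}^1|\psi'|^2\,dx_2}{|B|^2\int_{-1}^1|\psi|^2\,dx_2},$$ the second one being used only for $|B|<|B|_c$. For $\xi\in\mathbb R$ consider the normal-mode problem for the horizontal magnetic field $\bar B=(B,0)$ in dimension two, with unknowns $\lambda>0$ and a real function $\psi=\psi(x_2)$ on $[-1,1]$: $$-\lambda^2\rho(|\xi|^2\psi-\psi'')=\mu\lambda(|\xi|^4\psi-2|\xi|^2\psi''+\psi'''')+|B|^2(|\xi|^4\psi-|\xi|^2\psi'')\quad\text{on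 }(-1,0)\text{ and }(0,1),$$ $$\llbracket\psi\rrbracket=\llbracket\psi'\rrbracket=0,\qquad \llbracket\mu\lambda(|\xi|^2\psi+\psi'')\rrbracket=0,\qquad \llbracket\mu\lambda(\psi'''-3|\xi|^2\psi')\rrbracket=\llbracket\lambda^2\rho\psi'\rrbracket+g[\rho]|\xi|^2\psi(0),$$ $$\psi(-1)=\psi(1)=\psi'(-1)=\psi'(1)=0.$$ (i) If $|B|\ge|B|_c$, then for every $\xi\in\mathbb R$ the problem has no solution with $\lambda>0$ and $\psi\not\equiv0$. (ii) If $|B|<|B|_c$, then for every $\xi\in\mathbb R$ with $|\xi|\ge|\xi|_{hc}^B$ the problem has no solution with $\lambda>0$ and $\psi\not\equiv0$. (iii) If $|B|<|B|_c$, then for every $\xi\in\mathbb R$ with $0<|\xi|<|\xi|_{hc}^B$ there is a solution $\lambda=\lambda(\xi)>0$, $\psi=\psi(\xi,\cdot)$ of the problem; these solutions can be chosen so that $\lambda(\xi)$ and $\psi(\xi,\cdot)$ are even in $\xi$, and $\psi(\xi,\cdot)$ is smooth on $(-1,0)$ and on $(0,1)$ with $\psi(\xi,0)\neq0$. -/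

import Mathlib

open Set Filter Topology MeasureTheory
open scoped ContDiff

namespace RayleighTaylorMHD

noncomputable section

/-- A quantity equal to the constant `aPlus` in the upper fluid `x₂ > 0` and to `aMinus` in the
lower fluid `x₂ < 0` (the value on the interface `x₂ = 0` is never used). -/
def twoPhase (aPlus aMinus : ℝ) (x : ℝ) : ℝ := if 0 < x then aPlus else aMinus

/-- The interfacial jump `⟦f⟧ = f₊(0) - f₋(0)` exists (both one-sided traces exist) and equals
`J`. -/
def HasJump (f : ℝ → ℝ) (J : ℝ) : Prop :=
  ∃ a b : ℝ, Tendsto f (𝓝[>] 0) (𝓝 a) ∧ Tendsto f (𝓝[<] 0) (𝓝 b) ∧ J = a - b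

/-- `φ` is the weak derivative of `ψ` on the interval `(-1,1)`. -/
def IsWeakDeriv (ψ φ : ℝ → ℝ) : Prop :=
  ∀ η : ℝ → ℝ, ContDiff ℝ ∞ η → HasCompactSupport η → tsupport η ⊆ Ioo (-1) 1 →
    ∫ x in Ioo (-1 : ℝ) 1, ψ x * deriv η x = -∫ x in Ioo (-1 : ℝ) 1, φ x * η x

/-- `ψ` is (the continuous representative of) an element of `H¹₀((-1,1))`, and `φ` is its weak
derivative. In one dimension every element of `H¹` has a unique representative that is continuous
on `[-1,1]`, so the values `ψ(0)`, `ψ(±1)` are those of this representative. -/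
structure IsH10 (ψ φ : ℝ → ℝ) : Prop where
  continuousOn : ContinuousOn ψ (Icc (-1) 1)
  memLp : MemLp φ 2 (volume.restrict (Ioo (-1) 1))
  weakDeriv : IsWeakDeriv ψ φ
  left : ψ (-1) = 0
  right : ψ 1 = 0

/-- The function `ψ` is not identically zero on `(-1,1)`. -/
def Nontriv (ψ : ℝ → ℝ) : Prop := ∃ x ∈ Ioo (-1 : ℝ) 1, ψ x ≠ 0

/-- The critical magnetic number `|B|_c ≥ 0`, where `|B|_c²` is the supremum of
`g[ρ] ψ(0)² / ∫ |ψ'|²` over the nonzero `ψ ∈ H¹₀((-1,1))`. The argument `jρ` is `[ρ] = ρ₊ - ρ₋`. -/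
def criticalB (g jρ : ℝ) : ℝ :=
  √(sSup {q : ℝ | ∃ ψ φ : ℝ → ℝ, IsH10 ψ φ ∧ Nontriv ψ ∧
    q = g * jρ * ψ 0 ^ 2 / ∫ x in Ioo (-1 : ℝ) 1, φ x ^ 2})

/-- The critical frequency `|ξ|_{hc}^B ≥ 0` for the horizontal magnetic number, whose square is the
supremum of `(g[ρ] ψ(0)² - |B|² ∫ |ψ'|²) / (|B|² ∫ |ψ|²)` over the nonzero `ψ ∈ H¹₀((-1,1))`. -/
def criticalFreqH (g jρ B : ℝ) : ℝ :=
  √(sSup {q : ℝ | ∃ ψ φ : ℝ → ℝ, IsH10 ψ φ ∧ Nontriv ψ ∧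
    q = (g * jρ * ψ 0 ^ 2 - |B| ^ 2 * ∫ x in Ioo (-1 : ℝ) 1, φ x ^ 2) /
      (|B| ^ 2 * ∫ x in Ioo (-1 : ℝ) 1, ψ x ^ 2)})

/-- `(lam, ψ)` solves (classically in each fluid) the two-dimensional normal-mode problem with
horizontal magnetic number `(B,0)` at the frequency `ξ`. -/
structure IsNormalMode (g ρp ρm μp μm B ξ lam : ℝ) (ψ : ℝ → ℝ) : Prop where
  /-- `ψ` is a function on `[-1,1]`, continuous across the interface: `⟦ψ⟧ = 0`. -/
  continuousOn : ContinuousOn ψ (Icc (-1) 1)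
  contDiffOn_lower : ContDiffOn ℝ 4 ψ (Ioo (-1) 0)
  contDiffOn_upper : ContDiffOn ℝ 4 ψ (Ioo 0 1)
  /-- The fourth-order equation in both fluids. -/
  ode : ∀ x ∈ Ioo (-1 : ℝ) 0 ∪ Ioo 0 1,
    -lam ^ 2 * twoPhase ρp ρm x * (|ξ| ^ 2 * ψ x - iteratedDeriv 2 ψ x) =
      twoPhase μp μm x * lam *
        (|ξ| ^ 4 * ψ x - 2 * |ξ| ^ 2 * iteratedDeriv 2 ψ x + iteratedDeriv 4 ψ x) +
      |B| ^ 2 * (|ξ| ^ 2 * ξ ^ 2 * ψ x - ξ ^ 2 * iteratedDeriv 2 ψ x)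
  /-- `⟦ψ'⟧ = 0`. -/
  jump_deriv : HasJump (deriv ψ) 0
  /-- `⟦μ λ (|ξ|² ψ + ψ'')⟧ = 0`. -/
  jump_two : HasJump
    (fun x => twoPhase μp μm x * lam * (|ξ| ^ 2 * ψ x + iteratedDeriv 2 ψ x)) 0
  /-- `⟦μ λ (ψ''' - 3 |ξ|² ψ')⟧ = ⟦λ² ρ ψ'⟧ + g [ρ] |ξ|² ψ(0)`. -/
  jump_three : ∃ J : ℝ, HasJump (fun x => lam ^ 2 * twoPhase ρp ρm x * deriv ψ x) J ∧
    HasJump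
      (fun x => twoPhase μp μm x * lam * (iteratedDeriv 3 ψ x - 3 * |ξ| ^ 2 * deriv ψ x))
      (J + g * (ρp - ρm) * |ξ| ^ 2 * ψ 0)
  left : ψ (-1) = 0
  right : ψ 1 = 0
  /-- `ψ'(-1) = 0`, as a one-sided trace. -/
  deriv_left : Tendsto (deriv ψ) (𝓝[>] (-1)) (𝓝 0)
  /-- `ψ'(1) = 0`, as a one-sided trace. -/
  deriv_right : Tendsto (deriv ψ) (𝓝[<] 1) (𝓝 0)

end

end RayleighTaylorMHD

namespace RayleighTaylorMHD

noncomputable section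

/-! Write `k = |ξ|`, `α = λ²ρ + |B|²k²`, `ν = λμ`. Testing the equation with `ψ` and integrating by
parts in each fluid turns the walls and jump conditions into `E(ψ,ψ) = g[ρ]k²ψ(0)²`, where `E` is a
sum of squares with coefficients `α` and `ν` (`integral_energyDensity`, `IsResponse.energy_eq`).

Nonexistence: dropping the viscous squares from `E` leaves the inertial `H¹` energy with weight
`λ²ρ` plus `|B|²k²(∫|ψ'|² + k²∫ψ²)`. If the magnetic part already dominates `g[ρ]k²ψ(0)²`, the
inertial part vanishes and `ψ = 0`. So a growing mode violates the stability inequality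
(`IsNormalMode.exists_isH10_lt`), while the critical numbers are the constants for which that
inequality holds on `H¹₀` (`IsH10.le_criticalB`, `IsH10.le_criticalFreqH`).

Existence: fix `λ > 0` and apply a unit normal force at the interface. The solutions in each fluid
form an explicit four-dimensional space, so the response solves an 8 by 8 linear system, injective
by the energy identity (`exists_isResponse`). Let `h(λ)` be the value of this response at the
interface. It is a normal mode exactly when it reproduces its own force, that is `g[ρ]k² h(λ) = 1`.

Cauchy-Schwarz for `E` gives `η(0)² ≤ h(λ) E(η,η)` for every admissible `η`, with equality for the
response. Comparing energies at two values of `λ`, `h` decreases and `λ²h` increases, hence `h` is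
continuous. For large `λ` inertia makes `h` small. As `λ → 0` only the magnetic energy survives, and
below the critical frequency a trial function makes `g[ρ]k² h ≥ 1`. The intermediate value theorem
finishes (`exists_growth_rate`). Trial functions must be smooth and clamped at the walls, whereas
the critical frequency is a supremum over `H¹₀`; density of test functions closes the gap
(`IsH10.exists_isTest_lt`). -/

/-! ### Test functions and the du Bois-Reymond lemma. -/

/-- Smooth functions with compact support in `(-1,1)`. -/
structure IsTest (η : ℝ → ℝ) : Prop where
  contDiff : ContDiff ℝ ∞ η
  hasCompactSupport : HasCompactSupport η
  tsupport_subset : tsupport η ⊆ Ioo (-1) 1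

theorem integral_Ioo_eq (f : ℝ → ℝ) {a b : ℝ} (h : a ≤ b) :
    ∫ x in Ioo a b, f x = ∫ x in a..b, f x := by
  rw [intervalIntegral.integral_of_le h, integral_Ioc_eq_integral_Ioo]

theorem IsTest.exists_radius {η : ℝ → ℝ} (h : IsTest η) :
    ∃ r : ℝ, 0 < r ∧ r < 1 ∧ ∀ x, r ≤ |x| → η x = 0 := by
  rcases (tsupport η).eq_empty_or_nonempty with he | hne
  · refine ⟨1 / 2, by norm_num, by norm_num, fun x _ => ?_⟩
    exact image_eq_zero_of_notMem_tsupport (by simp [he])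
  · obtain ⟨x₀, hx₀, hmax⟩ :=
      h.hasCompactSupport.isCompact.exists_isMaxOn hne (continuous_abs.continuousOn)
    have h1 : |x₀| < 1 := abs_lt.2 (h.tsupport_subset hx₀)
    refine ⟨(|x₀| + 1) / 2, by positivity, by linarith, fun x hx => ?_⟩
    refine image_eq_zero_of_notMem_tsupport fun hx' => ?_
    have := hmax hx'
    simp only [mem_ofPred_eq] at this
    linarith

theorem isTest_of_radius {η : ℝ → ℝ} (hη : ContDiff ℝ ∞ η) {r : ℝ} (hr : r < 1)
    (h : ∀ x, r ≤ |x| → η x = 0) : IsTest η := by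
  have hs : tsupport η ⊆ Icc (-r) r := by
    refine closure_minimal (fun x hx => ?_) isClosed_Icc
    by_contra hx'
    refine hx (h x ?_)
    by_contra hlt
    exact hx' ⟨(abs_lt.1 (not_le.1 hlt)).1.le, (abs_lt.1 (not_le.1 hlt)).2.le⟩
  exact ⟨hη, HasCompactSupport.of_support_subset_isCompact isCompact_Icc
    ((subset_tsupport η).trans hs), hs.trans (Icc_subset_Ioo (by linarith) hr)⟩

theorem contDiff_integral {f : ℝ → ℝ} (hf : ContDiff ℝ ∞ f) (a : ℝ) :
    ContDiff ℝ ∞ (fun x => ∫ t in a..x, f t) := by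
  have hd : ∀ x, HasDerivAt (fun x => ∫ t in a..x, f t) (f x) x := fun x =>
    intervalIntegral.integral_hasDerivAt_right (hf.continuous.intervalIntegrable _ _)
      (hf.continuous.stronglyMeasurableAtFilter _ _) hf.continuous.continuousAt
  rw [contDiff_infty_iff_deriv]
  refine ⟨fun x => (hd x).differentiableAt, ?_⟩
  rwa [show deriv (fun x => ∫ t in a..x, f t) = f from funext fun x => (hd x).deriv]

theorem deriv_integral_of_continuous {f : ℝ → ℝ} (hf : Continuous f) (a : ℝ) :
    deriv (fun x => ∫ t in a..x, f t) = f :=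
  funext fun _ => (intervalIntegral.integral_hasDerivAt_right (hf.intervalIntegrable _ _)
      (hf.stronglyMeasurableAtFilter _ _) hf.continuousAt).deriv

/-- A test function with vanishing mean is the derivative of a test function. -/
theorem IsTest.integral {θ : ℝ → ℝ} (h : IsTest θ) (h0 : ∫ x in (-1 : ℝ)..1, θ x = 0) :
    IsTest (fun x => ∫ t in (-1 : ℝ)..x, θ t) := by
  obtain ⟨r, hr0, hr1, hr⟩ := h.exists_radius
  have hc := h.contDiff.continuous
  refine isTest_of_radius (contDiff_integral h.contDiff _) hr1 fun x hx => ?_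
  rcases le_abs.1 hx with hx | hx
  · have h2 : ∫ t in x..1, θ t = 0 := by
      rw [intervalIntegral.integral_congr (g := fun _ => 0), intervalIntegral.integral_zero]
      intro t ht
      refine hr t (le_abs.2 (Or.inl ?_))
      exact (le_min hx hr1.le).trans ht.1
    have := intervalIntegral.integral_add_adjacent_intervals
      (hc.intervalIntegrable (-1) x (μ := volume)) (hc.intervalIntegrable x 1)
    linarith
  · rw [intervalIntegral.integral_congr (g := fun _ => 0), intervalIntegral.integral_zero]
    intro t ht
    refine hr t (le_abs.2 (Or.inr ?_))
    have := ht.2.trans (max_le (by linarith : (-1 : ℝ) ≤ -r) (by linarith))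
    linarith

theorem IsTest.integrableOn_mul {η f : ℝ → ℝ} (h : IsTest η)
    (hf : IntegrableOn f (Ioo (-1) 1)) : IntegrableOn (fun x => f x * η x) (Ioo (-1) 1) := by
  obtain ⟨C, hC⟩ := h.hasCompactSupport.exists_bound_of_continuous h.contDiff.continuous
  exact Integrable.mul_bdd (c := C) hf h.contDiff.continuous.aestronglyMeasurable
    (Eventually.of_forall hC)

theorem IsTest.deriv {η : ℝ → ℝ} (h : IsTest η) : IsTest (deriv η) :=
  ⟨h.contDiff.deriv', h.hasCompactSupport.deriv, tsupport_deriv_subset.trans h.tsupport_subset⟩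

/-- A test function of mean one. -/
theorem exists_isTest_integral_eq_one :
    ∃ η : ℝ → ℝ, IsTest η ∧ ∫ x in Ioo (-1 : ℝ) 1, η x = 1 := by
  let b : ContDiffBump (0 : ℝ) := ⟨1 / 4, 1 / 2, by norm_num, by norm_num⟩
  have h0 : ∀ x, 1 / 2 ≤ |x| → b.normed volume x = 0 := by
    intro x hx
    rw [← Function.notMem_support, b.support_normed_eq]
    have : b.rOut = 1 / 2 := rfl
    simpa [Real.norm_eq_abs, this] using hx
  refine ⟨b.normed volume, isTest_of_radius b.contDiff_normed (by norm_num) h0, ?_⟩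
  rw [setIntegral_eq_integral_of_forall_compl_eq_zero, b.integral_normed]
  intro x hx
  refine h0 x ?_
  by_contra hlt
  have := abs_lt.1 (not_le.1 hlt)
  exact hx ⟨by linarith, by linarith⟩

/-- The lemma of du Bois-Reymond on `(-1,1)`. -/
theorem ae_eq_const_of_integral_mul_deriv_eq_zero {f : ℝ → ℝ}
    (hf : IntegrableOn f (Ioo (-1) 1))
    (h : ∀ η, IsTest η → ∫ x in Ioo (-1 : ℝ) 1, f x * deriv η x = 0) :
    ∃ c : ℝ, ∀ᵐ x ∂(volume.restrict (Ioo (-1 : ℝ) 1)), f x = c := by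
  obtain ⟨η₀, hη₀, hint⟩ := exists_isTest_integral_eq_one
  -- Subtracting `s * η₀` removes the mean, so the difference is the derivative of a test function
  -- and `f` annihilates it.
  have key : ∀ η, IsTest η → ∫ x in Ioo (-1 : ℝ) 1,
      f x * η x = (∫ x in Ioo (-1 : ℝ) 1, η x) * ∫ x in Ioo (-1 : ℝ) 1, f x * η₀ x := by
    intro η hη
    set s := ∫ x in Ioo (-1 : ℝ) 1, η x with hs
    have hi : IntegrableOn η (Ioo (-1) 1) :=
      (hη.contDiff.continuous.integrable_of_hasCompactSupport hη.hasCompactSupport).integrableOn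
    have hi₀ : IntegrableOn η₀ (Ioo (-1) 1) :=
      (hη₀.contDiff.continuous.integrable_of_hasCompactSupport
        hη₀.hasCompactSupport).integrableOn
    have hθ : IsTest (fun x => η x - s * η₀ x) := by
      obtain ⟨r, hr0, hr1, hr⟩ := hη.exists_radius
      obtain ⟨r', hr0', hr1', hr'⟩ := hη₀.exists_radius
      refine isTest_of_radius (r := max r r')
        (hη.contDiff.sub (contDiff_const.mul hη₀.contDiff)) (max_lt hr1 hr1') fun x hx => ?_
      simp [hr x ((le_max_left _ _).trans hx), hr' x ((le_max_right _ _).trans hx)]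
    have hm : ∫ x in (-1 : ℝ)..1, (η x - s * η₀ x) = 0 := by
      rw [← integral_Ioo_eq _ (by norm_num), integral_sub hi (hi₀.const_mul s),
        integral_const_mul, hint, ← hs]
      ring
    have h1 := h _ (hθ.integral hm)
    rw [deriv_integral_of_continuous hθ.contDiff.continuous] at h1
    have h2 : ∀ x, f x * (η x - s * η₀ x) = f x * η x - s * (f x * η₀ x) := fun x => by ring
    simp only [h2] at h1
    rw [integral_sub (hη.integrableOn_mul hf) ((hη₀.integrableOn_mul hf).const_mul s),
      integral_const_mul] at h1
    linarith
  refine ⟨∫ x in Ioo (-1 : ℝ) 1, f x * η₀ x, ?_⟩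
  set c := ∫ x in Ioo (-1 : ℝ) 1, f x * η₀ x
  have hfc : IntegrableOn (fun x => f x - c) (Ioo (-1) 1) := by
    refine hf.sub (integrableOn_const ?_)
    simp
  have := isOpen_Ioo.ae_eq_zero_of_integral_contDiff_smul_eq_zero
    (μ := volume) (U := Ioo (-1 : ℝ) 1) hfc.locallyIntegrableOn (fun η h1 h2 h3 => by
      have hη : IsTest η := ⟨h1, h2, h3⟩
      have hi : IntegrableOn η (Ioo (-1) 1) :=
        (hη.contDiff.continuous.integrable_of_hasCompactSupport hη.hasCompactSupport).integrableOn
      rw [← setIntegral_eq_integral_of_forall_compl_eq_zero (s := Ioo (-1 : ℝ) 1)]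
      · have h2 : ∀ x, η x • (f x - c) = f x * η x - c * η x := fun x => by
          simp only [smul_eq_mul]; ring
        simp only [h2]
        rw [integral_sub (hη.integrableOn_mul hf) (hi.const_mul c), integral_const_mul, key η hη]
        ring
      · intro x hx
        rw [image_eq_zero_of_notMem_tsupport fun h' => hx (h3 h'), zero_smul])
  rw [ae_restrict_iff' measurableSet_Ioo]
  filter_upwards [this] with x hx hx'
  linarith [hx hx']

/-! ### `H¹₀` in one dimension: primitives and trace inequalities. -/

theorem memLp_two_integrableOn {φ : ℝ → ℝ} (h : MemLp φ 2 (volume.restrict (Ioo (-1 : ℝ) 1))) :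
    IntegrableOn φ (Ioo (-1) 1) := by
  have : IsFiniteMeasure (volume.restrict (Ioo (-1 : ℝ) 1)) := by
    constructor; simp
  exact h.integrable (by norm_num)

theorem integrableOn_sq_of_memLp {φ : ℝ → ℝ} (h : MemLp φ 2 (volume.restrict (Ioo (-1 : ℝ) 1))) :
    IntegrableOn (fun x => φ x ^ 2) (Ioo (-1) 1) := h.integrable_sq

theorem intervalIntegrable_of_integrableOn_Ioo {f : ℝ → ℝ} (h : IntegrableOn f (Ioo (-1) 1))
    {a b : ℝ} (ha : a ∈ Icc (-1 : ℝ) 1) (hb : b ∈ Icc (-1 : ℝ) 1) :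
    IntervalIntegrable f volume a b := by
  have : IntervalIntegrable f volume (-1) 1 := by
    rw [intervalIntegrable_iff_integrableOn_Ioo_of_le (by norm_num)]; exact h
  refine this.mono_set ?_
  rw [uIcc_of_le (by norm_num : (-1 : ℝ) ≤ 1)]
  exact uIcc_subset_Icc ha hb

theorem sq_integral_le {φ : ℝ → ℝ} {a b : ℝ} (hab : a ≤ b)
    (h1 : IntervalIntegrable φ volume a b)
    (h2 : IntervalIntegrable (fun x => φ x ^ 2) volume a b) :
    (∫ x in a..b, φ x) ^ 2 ≤ (b - a) * ∫ x in a..b, φ x ^ 2 := by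
  rcases hab.eq_or_lt with rfl | hlt
  · simp
  set I := ∫ x in a..b, φ x
  set m := I / (b - a)
  have hI : I = m * (b - a) := by
    have : b - a ≠ 0 := by linarith
    simp only [m]; field_simp
  have h0 : 0 ≤ ∫ x in a..b, (φ x ^ 2 - 2 * m * φ x + m ^ 2) :=
    intervalIntegral.integral_nonneg hab fun x _ => by nlinarith [sq_nonneg (φ x - m)]
  rw [intervalIntegral.integral_add (h2.sub (h1.const_mul _)) intervalIntegrable_const,
    intervalIntegral.integral_sub h2 (h1.const_mul _), intervalIntegral.integral_const_mul,
    intervalIntegral.integral_const, smul_eq_mul] at h0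
  change 0 ≤ (∫ x in a..b, φ x ^ 2) - 2 * m * I + (b - a) * m ^ 2 at h0
  have : 0 < b - a := by linarith
  rw [hI] at h0 ⊢
  nlinarith

/-- Integration by parts for a primitive of an integrable function against a test function. -/
theorem integral_primitive_mul_deriv {φ η : ℝ → ℝ} (hφ : IntegrableOn φ (Ioo (-1) 1))
    (hη : IsTest η) :
    ∫ x in Ioo (-1 : ℝ) 1, (∫ t in (-1 : ℝ)..x, φ t) * deriv η x =
      -∫ x in Ioo (-1 : ℝ) 1, φ x * η x := by
  have hI : IntervalIntegrable φ volume (-1) 1 :=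
    intervalIntegrable_of_integrableOn_Ioo hφ (by simp) (by simp)
  have h1 := hI.absolutelyContinuousOnInterval_intervalIntegral (c := -1) (by simp)
  have hηd : deriv (fun x => ∫ t in (-1 : ℝ)..x, deriv η t) = deriv η :=
    deriv_integral_of_continuous (hη.contDiff.continuous_deriv (by simp)) _
  have hη0 : ∀ x, 1 ≤ |x| → η x = 0 := by
    obtain ⟨r, hr0, hr1, hr⟩ := hη.exists_radius
    exact fun x hx => hr x (by linarith)
  have hηI : ∀ x, ∫ t in (-1 : ℝ)..x, deriv η t = η x := fun x => by
    rw [intervalIntegral.integral_deriv_eq_sub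
      (fun y _ => hη.contDiff.differentiable (by simp) y)
      ((hη.contDiff.continuous_deriv (by simp)).intervalIntegrable _ _),
      hη0 (-1) (by simp), sub_zero]
  have h2 : AbsolutelyContinuousOnInterval η (-1) 1 := by
    have := ((hη.contDiff.continuous_deriv (by simp)).intervalIntegrable
      (μ := volume) (-1) 1).absolutelyContinuousOnInterval_intervalIntegral (c := -1) (by simp)
    simpa only [hηI] using this
  have h3 := h1.integral_mul_deriv_eq_deriv_mul h2
  rw [hη0 1 (by simp), hη0 (-1) (by simp)] at h3
  rw [integral_Ioo_eq _ (by norm_num), integral_Ioo_eq _ (by norm_num), h3]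
  simp only [mul_zero, sub_zero, zero_sub]
  congr 1
  refine intervalIntegral.integral_congr_ae ?_
  filter_upwards [hI.ae_hasDerivAt_integral] with x hx hx'
  rw [(hx (uIoc_subset_uIcc hx') (-1) (by simp)).deriv]

/-- The continuous representative of an `H¹₀` function is the primitive of its weak derivative. -/
theorem IsH10.eq_integral {ψ φ : ℝ → ℝ} (h : IsH10 ψ φ) :
    ∀ x ∈ Icc (-1 : ℝ) 1, ψ x = ∫ t in (-1 : ℝ)..x, φ t := by
  have hφ := memLp_two_integrableOn h.memLp
  have hΦ : ContinuousOn (fun x => ∫ t in (-1 : ℝ)..x, φ t) (Icc (-1) 1) := by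
    have := intervalIntegral.continuousOn_primitive_interval' (μ := volume)
      (intervalIntegrable_of_integrableOn_Ioo hφ (a := -1) (b := 1) (by simp) (by simp))
      (a := -1) (by simp)
    rwa [uIcc_of_le (by norm_num)] at this
  have hd : ContinuousOn (fun x => ψ x - ∫ t in (-1 : ℝ)..x, φ t) (Icc (-1) 1) :=
    h.continuousOn.sub hΦ
  have hint : ∀ {f : ℝ → ℝ}, ContinuousOn f (Icc (-1) 1) → IntegrableOn f (Ioo (-1) 1) :=
    fun hf => (hf.integrableOn_Icc).mono_set Ioo_subset_Icc_self
  -- `ψ` minus the primitive of `φ` has zero weak derivative. Continuity then makes it constant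
  -- everywhere, and it vanishes at `-1`.
  obtain ⟨c, hc⟩ := ae_eq_const_of_integral_mul_deriv_eq_zero (hint hd) (fun η hη => by
    simp only [sub_mul]
    rw [integral_sub (hη.deriv.integrableOn_mul (hint h.continuousOn))
      (hη.deriv.integrableOn_mul (hint hΦ)),
      h.weakDeriv η hη.contDiff hη.hasCompactSupport hη.tsupport_subset,
      integral_primitive_mul_deriv hφ hη, sub_self])
  have hEq : EqOn (fun x => ψ x - ∫ t in (-1 : ℝ)..x, φ t) (fun _ => c) (Icc (-1) 1) := by
    have h1 : EqOn (fun x => ψ x - ∫ t in (-1 : ℝ)..x, φ t) (fun _ => c) (Ioo (-1) 1) :=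
      Measure.eqOn_open_of_ae_eq hc isOpen_Ioo (hd.mono Ioo_subset_Icc_self) continuousOn_const
    have h2 : Icc (-1 : ℝ) 1 ⊆ closure (Ioo (-1) 1) := by
      rw [closure_Ioo (by norm_num)]
    exact h1.of_subset_closure hd continuousOn_const Ioo_subset_Icc_self h2
  have h0 := hEq (show (-1 : ℝ) ∈ Icc (-1 : ℝ) 1 by simp)
  simp only [h.left, intervalIntegral.integral_same, sub_zero] at h0
  intro x hx
  have := hEq hx
  simp only at this
  linarith

theorem integral_sq_le_of_subset {φ : ℝ → ℝ}
    (h2 : IntegrableOn (fun x => φ x ^ 2) (Ioo (-1) 1))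
    {a b : ℝ} (ha : a ∈ Icc (-1 : ℝ) 1) (hb : b ∈ Icc (-1 : ℝ) 1) (hab : a ≤ b) :
    ∫ t in a..b, φ t ^ 2 ≤ ∫ t in Ioo (-1 : ℝ) 1, φ t ^ 2 := by
  rw [← integral_Ioo_eq _ hab]
  exact setIntegral_mono_set h2 (ae_of_all _ fun x => sq_nonneg _)
    (Ioo_subset_Ioo ha.1 hb.2).eventuallyLE

theorem sq_integral_le_of_memLp {φ : ℝ → ℝ} (h : MemLp φ 2 (volume.restrict (Ioo (-1 : ℝ) 1)))
    {a b : ℝ} (ha : a ∈ Icc (-1 : ℝ) 1) (hb : b ∈ Icc (-1 : ℝ) 1) (hab : a ≤ b) :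
    (∫ t in a..b, φ t) ^ 2 ≤ (b - a) * ∫ t in Ioo (-1 : ℝ) 1, φ t ^ 2 := by
  have h1 := intervalIntegrable_of_integrableOn_Ioo (memLp_two_integrableOn h) ha hb
  have h2 := intervalIntegrable_of_integrableOn_Ioo (integrableOn_sq_of_memLp h) ha hb
  refine (sq_integral_le hab h1 h2).trans ?_
  exact mul_le_mul_of_nonneg_left
    (integral_sq_le_of_subset (integrableOn_sq_of_memLp h) ha hb hab) (by linarith)

theorem IsH10.sq_sub_le {ψ φ : ℝ → ℝ} (h : IsH10 ψ φ) {a b : ℝ} (ha : a ∈ Icc (-1 : ℝ) 1)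
    (hb : b ∈ Icc (-1 : ℝ) 1) (hab : a ≤ b) :
    (ψ b - ψ a) ^ 2 ≤ (b - a) * ∫ t in Ioo (-1 : ℝ) 1, φ t ^ 2 := by
  have hi := memLp_two_integrableOn h.memLp
  have h1 := intervalIntegral.integral_interval_sub_left
    (intervalIntegrable_of_integrableOn_Ioo hi (by simp) hb)
    (intervalIntegrable_of_integrableOn_Ioo hi (show (-1 : ℝ) ∈ Icc (-1 : ℝ) 1 by simp) ha)
  rw [h.eq_integral a ha, h.eq_integral b hb, h1]
  exact sq_integral_le_of_memLp h.memLp ha hb hab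

theorem IsH10.sq_apply_zero_le {ψ φ : ℝ → ℝ} (h : IsH10 ψ φ) :
    ψ 0 ^ 2 ≤ ∫ t in Ioo (-1 : ℝ) 1, φ t ^ 2 := by
  have := h.sq_sub_le (a := -1) (b := 0) (by simp) (by simp) (by simp)
  rw [h.left] at this
  linarith

/-- Trace inequality with a small constant in front of the Dirichlet integral. -/
theorem IsH10.trace_le {ψ φ : ℝ → ℝ} (h : IsH10 ψ φ) {δ : ℝ} (hδ : 0 < δ) (hδ1 : δ ≤ 1) :
    ψ 0 ^ 2 ≤ 2 / δ * (∫ x in Ioo (-1 : ℝ) 1, ψ x ^ 2) +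
      2 * δ * ∫ x in Ioo (-1 : ℝ) 1, φ x ^ 2 := by
  set P := ∫ x in Ioo (-1 : ℝ) 1, φ x ^ 2
  have hP : 0 ≤ P := integral_nonneg fun x => sq_nonneg _
  have hψ2 : ContinuousOn (fun x => ψ x ^ 2) (Icc (-1) 1) := h.continuousOn.pow 2
  have hψi : IntegrableOn (fun x => ψ x ^ 2) (Ioo (-1) 1) :=
    hψ2.integrableOn_Icc.mono_set Ioo_subset_Icc_self
  -- Average over `(0,δ)` the bound `ψ(0)² ≤ 2ψ(x)² + 2(ψ(x) - ψ(0))²`, whose last square is at most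
  -- `xP ≤ δP` before doubling.
  have h1 : ∫ x in (0 : ℝ)..δ, ψ 0 ^ 2 ≤ ∫ x in (0 : ℝ)..δ, (2 * ψ x ^ 2 + 2 * (δ * P)) := by
    have hi : IntervalIntegrable (fun x => ψ x ^ 2) volume 0 δ :=
      intervalIntegrable_of_integrableOn_Ioo hψi (by simp) ⟨by linarith, hδ1⟩
    refine intervalIntegral.integral_mono_on hδ.le intervalIntegrable_const
      ((hi.const_mul 2).add intervalIntegrable_const) fun x hx => ?_
    have := h.sq_sub_le (a := 0) (b := x) (by simp) ⟨by linarith [hx.1], hx.2.trans hδ1⟩ hx.1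
    have hxP : (x - 0) * P ≤ δ * P := mul_le_mul_of_nonneg_right (by linarith [hx.2]) hP
    nlinarith [sq_nonneg (ψ x - ψ 0 + ψ x)]
  have hi : IntervalIntegrable (fun x => ψ x ^ 2) volume 0 δ :=
    intervalIntegrable_of_integrableOn_Ioo hψi (by simp) ⟨by linarith, hδ1⟩
  rw [intervalIntegral.integral_add (hi.const_mul 2) intervalIntegrable_const,
    intervalIntegral.integral_const_mul, intervalIntegral.integral_const,
    intervalIntegral.integral_const, smul_eq_mul, smul_eq_mul, sub_zero] at h1
  have h2 := integral_sq_le_of_subset hψi (a := 0) (b := δ) (by simp) ⟨by linarith, hδ1⟩ hδ.le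
  have h3 : δ * ψ 0 ^ 2 ≤ δ * (2 / δ * (∫ x in Ioo (-1 : ℝ) 1, ψ x ^ 2) + 2 * δ * P) := by
    have : δ * (2 / δ * (∫ x in Ioo (-1 : ℝ) 1, ψ x ^ 2) + 2 * δ * P) =
      2 * (∫ x in Ioo (-1 : ℝ) 1, ψ x ^ 2) + δ * (2 * (δ * P)) := by
      field_simp
    rw [this]
    linarith
  exact le_of_mul_le_mul_left h3 hδ

/-! ### The critical numbers as constants in inequalities on `H¹₀`. -/

theorem bddAbove_criticalB {c : ℝ} (hc : 0 ≤ c) :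
    BddAbove {q : ℝ | ∃ ψ φ : ℝ → ℝ, IsH10 ψ φ ∧ Nontriv ψ ∧
      q = c * ψ 0 ^ 2 / ∫ x in Ioo (-1 : ℝ) 1, φ x ^ 2} := by
  refine ⟨c, ?_⟩
  rintro q ⟨ψ, φ, h, -, rfl⟩
  refine div_le_of_le_mul₀ (integral_nonneg fun x => sq_nonneg _) hc ?_
  exact mul_le_mul_of_nonneg_left h.sq_apply_zero_le hc

theorem bddAbove_criticalFreqH {c B : ℝ} (hc : 0 ≤ c) (hB : B ≠ 0) :
    BddAbove {q : ℝ | ∃ ψ φ : ℝ → ℝ, IsH10 ψ φ ∧ Nontriv ψ ∧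
      q = (c * ψ 0 ^ 2 - |B| ^ 2 * ∫ x in Ioo (-1 : ℝ) 1, φ x ^ 2) /
        (|B| ^ 2 * ∫ x in Ioo (-1 : ℝ) 1, ψ x ^ 2)} := by
  have hB2 : 0 < |B| ^ 2 := by positivity
  -- With this `δ` the Dirichlet term of the trace inequality, multiplied by `c`, is absorbed by
  -- `|B|² ∫ φ²`. The `+ 1` keeps the denominator positive when `c = 0`.
  set δ := min 1 (|B| ^ 2 / (2 * (c + 1))) with hδdef
  have hδ : 0 < δ := lt_min one_pos (by positivity)
  have hδc : 2 * δ * c ≤ |B| ^ 2 := by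
    have h1 : δ ≤ |B| ^ 2 / (2 * (c + 1)) := min_le_right _ _
    rw [le_div_iff₀ (by positivity)] at h1
    nlinarith
  refine ⟨c * (2 / δ) / |B| ^ 2, ?_⟩
  rintro q ⟨ψ, φ, h, -, rfl⟩
  have hP : 0 ≤ ∫ x in Ioo (-1 : ℝ) 1, φ x ^ 2 := integral_nonneg fun x => sq_nonneg _
  have hS : 0 ≤ ∫ x in Ioo (-1 : ℝ) 1, ψ x ^ 2 := integral_nonneg fun x => sq_nonneg _
  refine div_le_of_le_mul₀ (by positivity) (by positivity) ?_
  have h1 := mul_le_mul_of_nonneg_left (h.trace_le hδ (min_le_left _ _)) hc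
  have h2 := mul_le_mul_of_nonneg_right hδc hP
  have h3 : c * (2 / δ) / |B| ^ 2 * (|B| ^ 2 * ∫ x in Ioo (-1 : ℝ) 1, ψ x ^ 2) =
      c * (2 / δ * ∫ x in Ioo (-1 : ℝ) 1, ψ x ^ 2) := by
    field_simp
  rw [h3]
  linarith

theorem IsH10.integral_sq_pos {ψ φ : ℝ → ℝ} (h : IsH10 ψ φ) (hn : Nontriv ψ) :
    0 < ∫ x in Ioo (-1 : ℝ) 1, ψ x ^ 2 := by
  obtain ⟨x, hx, hx0⟩ := hn
  rw [integral_Ioo_eq _ (by norm_num)]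
  refine intervalIntegral.integral_pos (by norm_num) (h.continuousOn.pow 2)
    (fun y _ => sq_nonneg _) ⟨x, Ioo_subset_Icc_self hx, by positivity⟩

theorem IsH10.le_criticalB {ψ φ : ℝ → ℝ} (h : IsH10 ψ φ) (hn : Nontriv ψ) {g j : ℝ}
    (hgj : 0 ≤ g * j) :
    g * j * ψ 0 ^ 2 ≤ criticalB g j ^ 2 * ∫ x in Ioo (-1 : ℝ) 1, φ x ^ 2 := by
  have hP : 0 ≤ ∫ x in Ioo (-1 : ℝ) 1, φ x ^ 2 := integral_nonneg fun x => sq_nonneg _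
  -- For a vanishing Dirichlet integral the quotient is `0` by convention and carries no
  -- information; the trace bound replaces it.
  rcases hP.eq_or_lt with h0 | hpos
  · have := mul_le_mul_of_nonneg_left h.sq_apply_zero_le hgj
    rw [← h0] at this ⊢
    linarith
  have hle := le_csSup (bddAbove_criticalB hgj) ⟨ψ, φ, h, hn, rfl⟩
  have h0 : 0 ≤ g * j * ψ 0 ^ 2 / ∫ x in Ioo (-1 : ℝ) 1, φ x ^ 2 := by positivity
  rw [criticalB, Real.sq_sqrt (h0.trans hle)]
  rwa [div_le_iff₀ hpos] at hle

theorem IsH10.le_criticalFreqH {ψ φ : ℝ → ℝ} (h : IsH10 ψ φ) (hn : Nontriv ψ) {g j B : ℝ}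
    (hgj : 0 ≤ g * j) (hB : B ≠ 0) :
    g * j * ψ 0 ^ 2 - |B| ^ 2 * ∫ x in Ioo (-1 : ℝ) 1, φ x ^ 2 ≤
      criticalFreqH g j B ^ 2 * (|B| ^ 2 * ∫ x in Ioo (-1 : ℝ) 1, ψ x ^ 2) := by
  have hpos : 0 < |B| ^ 2 * ∫ x in Ioo (-1 : ℝ) 1, ψ x ^ 2 :=
    mul_pos (by positivity) (h.integral_sq_pos hn)
  have hle := le_csSup (bddAbove_criticalFreqH hgj hB) ⟨ψ, φ, h, hn, rfl⟩
  rw [div_le_iff₀ hpos] at hle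
  refine hle.trans (mul_le_mul_of_nonneg_right ?_ hpos.le)
  rw [criticalFreqH]
  rcases le_total 0 (sSup {q : ℝ | ∃ ψ φ : ℝ → ℝ, IsH10 ψ φ ∧ Nontriv ψ ∧
    q = (g * j * ψ 0 ^ 2 - |B| ^ 2 * ∫ x in Ioo (-1 : ℝ) 1, φ x ^ 2) /
      (|B| ^ 2 * ∫ x in Ioo (-1 : ℝ) 1, ψ x ^ 2)}) with h' | h'
  · rw [Real.sq_sqrt h']
  -- When the supremum is not positive its square root is `0`, and the truncation only weakens the
  -- bound.
  · exact h'.trans (sq_nonneg _)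

/-! ### Density of test functions in `H¹₀`. -/

theorem IsTest.memLp {η : ℝ → ℝ} (h : IsTest η) :
    MemLp η 2 (volume.restrict (Ioo (-1 : ℝ) 1)) :=
  (h.contDiff.continuous.memLp_of_hasCompactSupport h.hasCompactSupport).restrict _

theorem IsTest.add_smul {η θ : ℝ → ℝ} (hη : IsTest η) (hθ : IsTest θ) (s : ℝ) :
    IsTest (fun x => η x + s * θ x) := by
  obtain ⟨r, hr0, hr1, hr⟩ := hη.exists_radius
  obtain ⟨r', hr0', hr1', hr'⟩ := hθ.exists_radius
  refine isTest_of_radius (r := max r r')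
    (hη.contDiff.add (contDiff_const.mul hθ.contDiff)) (max_lt hr1 hr1') fun x hx => ?_
  simp [hr x ((le_max_left _ _).trans hx), hr' x ((le_max_right _ _).trans hx)]

theorem isTest_zero : IsTest (fun _ => 0) :=
  isTest_of_radius contDiff_const (r := 0) (by norm_num) fun _ _ => rfl

theorem IsTest.deriv_add_smul {η θ : ℝ → ℝ} (hη : IsTest η) (hθ : IsTest θ) (s : ℝ) (x : ℝ) :
    _root_.deriv (fun x => η x + s * θ x) x = _root_.deriv η x + s * _root_.deriv θ x := by
  have h1 : DifferentiableAt ℝ η x := hη.contDiff.differentiable (by simp) x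
  have h2 : DifferentiableAt ℝ θ x := hθ.contDiff.differentiable (by simp) x
  rw [deriv_fun_add h1 (h2.const_mul s), deriv_const_mul _ h2]

/-- The derivatives of test functions, as a subspace of `L²(-1,1)`. -/
def testDerivs : Submodule ℝ (Lp ℝ 2 (volume.restrict (Ioo (-1 : ℝ) 1))) where
  carrier := {f | ∃ χ, IsTest χ ∧ f =ᵐ[volume.restrict (Ioo (-1 : ℝ) 1)] deriv χ}
  add_mem' := by
    rintro f f' ⟨χ, hχ, h⟩ ⟨χ', hχ', h'⟩
    refine ⟨_, hχ.add_smul hχ' 1, ?_⟩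
    filter_upwards [h, h', Lp.coeFn_add f f'] with x h1 h2 h3
    rw [h3, hχ.deriv_add_smul hχ', Pi.add_apply, h1, h2, one_mul]
  zero_mem' := by
    refine ⟨_, isTest_zero, ?_⟩
    filter_upwards [Lp.coeFn_zero ℝ 2 (volume.restrict (Ioo (-1 : ℝ) 1))] with x h1
    rw [h1]; simp
  smul_mem' := by
    rintro s f ⟨χ, hχ, h⟩
    refine ⟨_, isTest_zero.add_smul hχ s, ?_⟩
    filter_upwards [h, Lp.coeFn_smul s f] with x h1 h3
    rw [h3, isTest_zero.deriv_add_smul hχ, Pi.smul_apply, h1]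
    simp

/-- Derivatives of test functions are dense among the `L²` functions of mean zero. -/
theorem exists_isTest_deriv_approx {φ : ℝ → ℝ}
    (hφ : MemLp φ 2 (volume.restrict (Ioo (-1 : ℝ) 1)))
    (h0 : ∫ x in Ioo (-1 : ℝ) 1, φ x = 0) {ε : ℝ} (hε : 0 < ε) :
    ∃ χ, IsTest χ ∧ ∫ x in Ioo (-1 : ℝ) 1, (φ x - deriv χ x) ^ 2 < ε := by
  -- The closure is the double orthogonal complement. By du Bois-Reymond, anything orthogonal to
  -- `testDerivs` is constant, and `φ` has mean zero.
  have hmem : hφ.toLp φ ∈ testDerivs.topologicalClosure := by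
    rw [← Submodule.orthogonal_orthogonal_eq_closure, Submodule.mem_orthogonal]
    intro f hf
    have hfi := memLp_two_integrableOn (Lp.memLp f)
    obtain ⟨c, hc⟩ := ae_eq_const_of_integral_mul_deriv_eq_zero hfi (fun η hη => by
      have := (Submodule.mem_orthogonal _ _).1 hf (hη.deriv.memLp.toLp _)
        ⟨η, hη, hη.deriv.memLp.coeFn_toLp⟩
      rw [L2.inner_def] at this
      rw [← this]
      refine integral_congr_ae ?_
      filter_upwards [hη.deriv.memLp.coeFn_toLp] with x hx
      simp [hx])
    rw [L2.inner_def]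
    have : ∫ x in Ioo (-1 : ℝ) 1, inner ℝ (f x) (hφ.toLp φ x) =
        ∫ x in Ioo (-1 : ℝ) 1, c * φ x := by
      refine integral_congr_ae ?_
      filter_upwards [hφ.coeFn_toLp, hc] with x hx hx'
      simp [hx, hx', mul_comm]
    rw [this, integral_const_mul, h0, mul_zero]
  obtain ⟨f, ⟨χ, hχ, hf⟩, hd⟩ := Metric.mem_closure_iff.1 hmem (√ε) (Real.sqrt_pos.2 hε)
  refine ⟨χ, hχ, ?_⟩
  have h1 : ∫ x in Ioo (-1 : ℝ) 1, (φ x - deriv χ x) ^ 2 = dist (hφ.toLp φ) f ^ 2 := by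
    rw [dist_eq_norm, ← real_inner_self_eq_norm_sq, L2.inner_def]
    refine integral_congr_ae ?_
    filter_upwards [hφ.coeFn_toLp, hf, Lp.coeFn_sub (hφ.toLp φ) f] with x hx hx' hx''
    rw [hx'', Pi.sub_apply, hx, hx']
    simp [sq]
  rw [h1]
  have := Real.sq_sqrt hε.le
  nlinarith [dist_nonneg (x := hφ.toLp φ) (y := f), Real.sqrt_nonneg ε]

/-- Young's inequality with a coefficient of `x²` close to `1`, so that a strict inequality survives
a small perturbation `y`. -/
theorem sq_add_le_weighted {t : ℝ} (ht : 0 < t) (x y : ℝ) :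
    (x + y) ^ 2 ≤ (1 + t) * x ^ 2 + (1 + 1 / t) * y ^ 2 := by
  have h : (1 + t) * x ^ 2 + (1 + 1 / t) * y ^ 2 - (x + y) ^ 2 = (t * x - y) ^ 2 / t := by
    field_simp; ring
  have : 0 ≤ (t * x - y) ^ 2 / t := by positivity
  linarith

theorem integral_sq_le_weighted {u v : ℝ → ℝ} {t : ℝ} (ht : 0 < t)
    (hu : MemLp u 2 (volume.restrict (Ioo (-1 : ℝ) 1)))
    (hv : MemLp v 2 (volume.restrict (Ioo (-1 : ℝ) 1))) :
    ∫ x in Ioo (-1 : ℝ) 1, v x ^ 2 ≤ (1 + t) * (∫ x in Ioo (-1 : ℝ) 1, u x ^ 2) +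
      (1 + 1 / t) * ∫ x in Ioo (-1 : ℝ) 1, (u x - v x) ^ 2 := by
  have h1 := hu.integrable_sq.const_mul (1 + t)
  have h2 := (hu.sub hv).integrable_sq.const_mul (1 + 1 / t)
  simp only [Pi.sub_apply] at h2
  rw [← integral_const_mul, ← integral_const_mul, ← integral_add h1 h2]
  refine integral_mono hv.integrable_sq (h1.add h2) fun x => ?_
  have := sq_add_le_weighted ht (u x) (-(u x - v x))
  ring_nf at this ⊢
  linarith

/-- A strict inequality between the trace and the energy that holds for some element of `H¹₀`
holds for some test function. -/
theorem IsH10.exists_isTest_lt {ψ φ : ℝ → ℝ} (h : IsH10 ψ φ) {a k : ℝ} (ha : 0 ≤ a)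
    (hlt : (∫ x in Ioo (-1 : ℝ) 1, φ x ^ 2) + k ^ 2 * (∫ x in Ioo (-1 : ℝ) 1, ψ x ^ 2) <
      a * ψ 0 ^ 2) :
    ∃ χ, IsTest χ ∧ (∫ x in Ioo (-1 : ℝ) 1, deriv χ x ^ 2) +
      k ^ 2 * (∫ x in Ioo (-1 : ℝ) 1, χ x ^ 2) < a * χ 0 ^ 2 := by
  by_contra! H
  set P := ∫ x in Ioo (-1 : ℝ) 1, φ x ^ 2
  set S := ∫ x in Ioo (-1 : ℝ) 1, ψ x ^ 2
  -- Young's inequality is used twice in succession, once for the trace and once for the integrals;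
  -- hence the square.
  obtain ⟨t, hts, ht⟩ : ∃ t : ℝ, (1 + t) ^ 2 * (P + k ^ 2 * S) < a * ψ 0 ^ 2 ∧ 0 < t := by
    have hc : Tendsto (fun t : ℝ => (1 + t) ^ 2 * (P + k ^ 2 * S)) (𝓝[>] 0)
        (𝓝 ((1 + 0) ^ 2 * (P + k ^ 2 * S))) :=
      tendsto_nhdsWithin_of_tendsto_nhds (Continuous.tendsto (by fun_prop) _)
    have := (hc.eventually_lt_const (by simpa using hlt)).and self_mem_nhdsWithin
    exact this.exists
  -- `M` collects the errors: `ε` from the derivative, `4ε` from the function in `L²`, `2ε` from its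
  -- value at `0`.
  set M := (1 + 1 / t) * ((1 + t) * (1 + 4 * k ^ 2) + 2 * a)
  obtain ⟨ε, hεs, hε⟩ : ∃ ε : ℝ, (1 + t) ^ 2 * (P + k ^ 2 * S) + M * ε < a * ψ 0 ^ 2 ∧ 0 < ε := by
    have hc : Tendsto (fun ε : ℝ => (1 + t) ^ 2 * (P + k ^ 2 * S) + M * ε) (𝓝[>] 0)
        (𝓝 ((1 + t) ^ 2 * (P + k ^ 2 * S) + M * 0)) :=
      tendsto_nhdsWithin_of_tendsto_nhds (Continuous.tendsto (by fun_prop) _)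
    exact ((hc.eventually_lt_const (by simpa using hts)).and self_mem_nhdsWithin).exists
  have h0 : ∫ x in Ioo (-1 : ℝ) 1, φ x = 0 := by
    rw [integral_Ioo_eq _ (by norm_num), ← h.eq_integral 1 (by simp), h.right]
  obtain ⟨χ, hχ, hχε⟩ := exists_isTest_deriv_approx h.memLp h0 hε
  have hχ' := H χ hχ
  have hφ := memLp_two_integrableOn h.memLp
  have hχi := memLp_two_integrableOn hχ.deriv.memLp
  -- `L²` closeness of the derivatives gives uniform closeness; `2` is the length of the interval.
  have hd : ∀ x ∈ Icc (-1 : ℝ) 1, (ψ x - χ x) ^ 2 ≤ 2 * ε := by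
    intro x hx
    have h1 : χ x = ∫ s in (-1 : ℝ)..x, deriv χ s := by
      obtain ⟨r, hr0, hr1, hr⟩ := hχ.exists_radius
      rw [intervalIntegral.integral_deriv_eq_sub
        (fun y _ => hχ.contDiff.differentiable (by simp) y)
        (hχ.deriv.contDiff.continuous.intervalIntegrable _ _), hr (-1) (by simp [hr1.le]),
        sub_zero]
    have h2 := sq_integral_le_of_memLp (h.memLp.sub hχ.deriv.memLp)
      (show (-1 : ℝ) ∈ Icc (-1 : ℝ) 1 by simp) hx hx.1
    simp only [Pi.sub_apply] at h2
    rw [intervalIntegral.integral_sub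
      (intervalIntegrable_of_integrableOn_Ioo hφ (by simp) hx)
      (intervalIntegrable_of_integrableOn_Ioo hχi (by simp) hx), ← h1,
      ← h.eq_integral x hx] at h2
    have h3 : (x - -1) * (∫ x in Ioo (-1 : ℝ) 1, (φ x - deriv χ x) ^ 2) ≤ 2 * ε :=
      mul_le_mul (by linarith [hx.2]) hχε.le (integral_nonneg fun x => sq_nonneg _) (by norm_num)
    exact h2.trans h3
  have hψL : MemLp ψ 2 (volume.restrict (Ioo (-1 : ℝ) 1)) := by
    obtain ⟨C, hC⟩ := isCompact_Icc.exists_bound_of_continuousOn h.continuousOn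
    have : IsFiniteMeasure (volume.restrict (Ioo (-1 : ℝ) 1)) := by constructor; simp
    refine MemLp.of_bound ((h.continuousOn.mono Ioo_subset_Icc_self).aestronglyMeasurable
      measurableSet_Ioo) C ?_
    filter_upwards [ae_restrict_mem measurableSet_Ioo] with x hx
    exact hC x (Ioo_subset_Icc_self hx)
  have hdS : ∫ x in Ioo (-1 : ℝ) 1, (ψ x - χ x) ^ 2 ≤ 4 * ε := by
    have : ∫ x in Ioo (-1 : ℝ) 1, (2 * ε) = 4 * ε := by
      simp; ring
    rw [← this]
    refine setIntegral_mono_on (hψL.sub hχ.memLp).integrable_sq (integrableOn_const (by simp))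
      measurableSet_Ioo fun x hx => hd x (Ioo_subset_Icc_self hx)
  have e1 := integral_sq_le_weighted ht h.memLp hχ.deriv.memLp
  have e2 := integral_sq_le_weighted ht hψL hχ.memLp
  have e3 := sq_add_le_weighted ht (χ 0) (ψ 0 - χ 0)
  rw [add_sub_cancel] at e3
  have hT : 0 < 1 + 1 / t := by positivity
  have e1' : ∫ x in Ioo (-1 : ℝ) 1, deriv χ x ^ 2 ≤ (1 + t) * P + (1 + 1 / t) * ε :=
    e1.trans (by gcongr)
  have e2' : ∫ x in Ioo (-1 : ℝ) 1, χ x ^ 2 ≤ (1 + t) * S + (1 + 1 / t) * (4 * ε) :=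
    e2.trans (by gcongr)
  have e3' : ψ 0 ^ 2 ≤ (1 + t) * χ 0 ^ 2 + (1 + 1 / t) * (2 * ε) :=
    e3.trans (by gcongr; exact hd 0 (by simp))
  have f1 : a * ψ 0 ^ 2 ≤ (1 + t) * (a * χ 0 ^ 2) + a * ((1 + 1 / t) * (2 * ε)) := by
    have := mul_le_mul_of_nonneg_left e3' ha
    linarith
  have f2 : a * χ 0 ^ 2 ≤ ((1 + t) * P + (1 + 1 / t) * ε) +
      k ^ 2 * ((1 + t) * S + (1 + 1 / t) * (4 * ε)) :=
    hχ'.trans (add_le_add e1' (mul_le_mul_of_nonneg_left e2' (sq_nonneg k)))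
  have f3 := mul_le_mul_of_nonneg_left f2 (show 0 ≤ 1 + t by positivity)
  have f4 : (1 + t) * (((1 + t) * P + (1 + 1 / t) * ε) +
      k ^ 2 * ((1 + t) * S + (1 + 1 / t) * (4 * ε))) + a * ((1 + 1 / t) * (2 * ε)) =
      (1 + t) ^ 2 * (P + k ^ 2 * S) + M * ε := by
    simp only [M]; ring
  linarith

/-! ### The energy form and Green's identity. -/

theorem hasDerivAt_iteratedDeriv {F : ℝ → ℝ} (hF : ContDiff ℝ ∞ F) (n : ℕ) (x : ℝ) :
    HasDerivAt (iteratedDeriv n F) (iteratedDeriv (n + 1) F x) x := by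
  rw [iteratedDeriv_succ]
  exact (hF.differentiable_iteratedDeriv n (by exact_mod_cast ENat.natCast_lt_top n) x).hasDerivAt

theorem hasDerivAt_self {F : ℝ → ℝ} (hF : ContDiff ℝ ∞ F) (x : ℝ) :
    HasDerivAt F (deriv F x) x := (hF.differentiable (by simp) x).hasDerivAt

theorem hasDerivAt_deriv {F : ℝ → ℝ} (hF : ContDiff ℝ ∞ F) (x : ℝ) :
    HasDerivAt (deriv F) (iteratedDeriv 2 F x) x := by
  simpa using hasDerivAt_iteratedDeriv hF 1 x

theorem continuous_iteratedDeriv_of_smooth {F : ℝ → ℝ} (hF : ContDiff ℝ ∞ F) (n : ℕ) :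
    Continuous (iteratedDeriv n F) :=
  hF.continuous_iteratedDeriv n (by exact_mod_cast le_top)

theorem continuous_deriv_of_smooth {F : ℝ → ℝ} (hF : ContDiff ℝ ∞ F) : Continuous (deriv F) :=
  hF.continuous_deriv (by simp)

/-- Density of the bilinear energy form with inertial-magnetic coefficient `α` and viscous
coefficient `ν`. -/
def energyDensity (α ν k : ℝ) (F χ : ℝ → ℝ) (x : ℝ) : ℝ :=
  α * (k ^ 2 * (F x * χ x) + deriv F x * deriv χ x) +
    ν * (4 * k ^ 2 * (deriv F x * deriv χ x) +
      (iteratedDeriv 2 F x + k ^ 2 * F x) * (iteratedDeriv 2 χ x + k ^ 2 * χ x))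

theorem continuous_energyDensity (α ν k : ℝ) {F χ : ℝ → ℝ} (hF : ContDiff ℝ ∞ F)
    (hχ : ContDiff ℝ ∞ χ) : Continuous (energyDensity α ν k F χ) := by
  have := hF.continuous
  have := hχ.continuous
  have := continuous_deriv_of_smooth hF
  have := continuous_deriv_of_smooth hχ
  have := continuous_iteratedDeriv_of_smooth hF 2
  have := continuous_iteratedDeriv_of_smooth hχ 2
  unfold energyDensity
  fun_prop

/-- The boundary expression in Green's identity. -/
def boundaryTerm (α ν k : ℝ) (F χ : ℝ → ℝ) (x : ℝ) : ℝ :=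
  α * (deriv F x * χ x) + ν * ((k ^ 2 * F x + iteratedDeriv 2 F x) * deriv χ x -
    (iteratedDeriv 3 F x - 3 * k ^ 2 * deriv F x) * χ x)

/-- The fourth-order equation of one fluid, with `α = λ²ρ + |B|²k²` and `ν = λμ`. -/
def SolvesODE (α ν k : ℝ) (F : ℝ → ℝ) : Prop :=
  ∀ x, ν * (k ^ 4 * F x - 2 * k ^ 2 * iteratedDeriv 2 F x + iteratedDeriv 4 F x) +
    α * (k ^ 2 * F x - iteratedDeriv 2 F x) = 0

/-- The derivative of `boundaryTerm` is the energy density minus `χ` times the left side of the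
equation for `F`. -/
theorem integral_energyDensity {α ν k : ℝ} {F χ : ℝ → ℝ} (hF : ContDiff ℝ ∞ F)
    (hχ : ContDiff ℝ ∞ χ) (ho : SolvesODE α ν k F) (a b : ℝ) :
    ∫ x in a..b, energyDensity α ν k F χ x =
      boundaryTerm α ν k F χ b - boundaryTerm α ν k F χ a := by
  refine intervalIntegral.integral_eq_sub_of_hasDerivAt (fun x _ => ?_)
    ((continuous_energyDensity α ν k hF hχ).intervalIntegrable _ _)
  have h0 := hasDerivAt_self hF x
  have h1 := hasDerivAt_deriv hF x
  have h2 := hasDerivAt_iteratedDeriv hF 2 x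
  have h3 := hasDerivAt_iteratedDeriv hF 3 x
  have c0 := hasDerivAt_self hχ x
  have c1 := hasDerivAt_deriv hχ x
  have := ((h1.mul c0).const_mul α).add (((((h0.const_mul (k ^ 2)).add h2).mul c1).sub
    ((h3.sub (h1.const_mul (3 * k ^ 2))).mul c0)).const_mul ν)
  refine this.congr_deriv ?_
  unfold energyDensity
  simp only [Pi.add_apply, Pi.sub_apply]
  linear_combination (-χ x) * ho x

/-- Pairs of smooth functions, on the lower and the upper fluid, that match to first order on the
interface and vanish to first order on the rigid walls. -/
structure Admissible (p q : ℝ → ℝ) : Prop where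
  smooth_lower : ContDiff ℝ ∞ p
  smooth_upper : ContDiff ℝ ∞ q
  left : p (-1) = 0
  deriv_left : deriv p (-1) = 0
  right : q 1 = 0
  deriv_right : deriv q 1 = 0
  jump : p 0 = q 0
  jump_deriv : deriv p 0 = deriv q 0

/-- The bilinear energy form of a pair. -/
def energy (αm αp νm νp k : ℝ) (p q χ η : ℝ → ℝ) : ℝ :=
  (∫ x in (-1 : ℝ)..0, energyDensity αm νm k p χ x) + ∫ x in (0 : ℝ)..1, energyDensity αp νp k q η x

/-- The pair `(p,q)` is the response of the two fluids to a normal force `c` on the interface. -/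
structure IsResponse (αm αp νm νp k c : ℝ) (p q : ℝ → ℝ) : Prop extends Admissible p q where
  ode_lower : SolvesODE αm νm k p
  ode_upper : SolvesODE αp νp k q
  jump_two : νp * (k ^ 2 * q 0 + iteratedDeriv 2 q 0) =
    νm * (k ^ 2 * p 0 + iteratedDeriv 2 p 0)
  jump_three : νp * (iteratedDeriv 3 q 0 - 3 * k ^ 2 * deriv q 0) -
    νm * (iteratedDeriv 3 p 0 - 3 * k ^ 2 * deriv p 0) = (αp - αm) * deriv q 0 + c

/-- The two jump conditions are the natural boundary conditions of the energy form: wall terms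
vanish, the `η'(0)` terms cancel by `jump_two`, and `jump_three` leaves only the work of the force
`c`. -/
theorem IsResponse.energy_eq {αm αp νm νp k c : ℝ} {p q χ η : ℝ → ℝ}
    (h : IsResponse αm αp νm νp k c p q) (hχ : Admissible χ η) :
    energy αm αp νm νp k p q χ η = c * η 0 := by
  rw [energy, integral_energyDensity h.smooth_lower hχ.smooth_lower h.ode_lower,
    integral_energyDensity h.smooth_upper hχ.smooth_upper h.ode_upper]
  simp only [boundaryTerm, hχ.left, hχ.deriv_left, hχ.right, hχ.deriv_right, hχ.jump,
    hχ.jump_deriv, h.jump_deriv]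
  have h3 := h.jump_three
  rw [h.jump_deriv] at h3
  linear_combination η 0 * h3 - deriv η 0 * h.jump_two

theorem energyDensity_self_ge {α ν : ℝ} (hν : 0 ≤ ν) (k : ℝ) (F : ℝ → ℝ) (x : ℝ) :
    α * (k ^ 2 * F x ^ 2 + deriv F x ^ 2) ≤ energyDensity α ν k F F x := by
  have : 0 ≤ ν * (4 * k ^ 2 * (deriv F x * deriv F x) +
      (iteratedDeriv 2 F x + k ^ 2 * F x) * (iteratedDeriv 2 F x + k ^ 2 * F x)) := by
    refine mul_nonneg hν (add_nonneg (mul_nonneg (by positivity) (mul_self_nonneg _))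
      (mul_self_nonneg _))
  unfold energyDensity
  nlinarith

theorem continuous_sobolevDensity (k : ℝ) {F : ℝ → ℝ} (hF : ContDiff ℝ ∞ F) :
    Continuous (fun x => k ^ 2 * F x ^ 2 + deriv F x ^ 2) := by
  have := hF.continuous
  have := continuous_deriv_of_smooth hF
  fun_prop

/-- The `H¹` energy of a pair, with weights. -/
def sobolev (αm αp k : ℝ) (p q : ℝ → ℝ) : ℝ :=
  αm * (∫ x in (-1 : ℝ)..0, (k ^ 2 * p x ^ 2 + deriv p x ^ 2)) +
    αp * ∫ x in (0 : ℝ)..1, (k ^ 2 * q x ^ 2 + deriv q x ^ 2)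

theorem sobolev_le_energy {αm αp νm νp : ℝ} (k : ℝ) {p q : ℝ → ℝ} (hp : ContDiff ℝ ∞ p)
    (hq : ContDiff ℝ ∞ q) (hνm : 0 ≤ νm) (hνp : 0 ≤ νp) :
    sobolev αm αp k p q ≤ energy αm αp νm νp k p q p q := by
  rw [sobolev, energy, ← intervalIntegral.integral_const_mul,
    ← intervalIntegral.integral_const_mul]
  refine add_le_add (intervalIntegral.integral_mono_on (by norm_num) ?_ ?_ fun x _ =>
    energyDensity_self_ge hνm k p x) (intervalIntegral.integral_mono_on (by norm_num) ?_ ?_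
    fun x _ => energyDensity_self_ge hνp k q x)
  · exact ((continuous_sobolevDensity k hp).const_mul αm).intervalIntegrable _ _
  · exact (continuous_energyDensity _ _ _ hp hp).intervalIntegrable _ _
  · exact ((continuous_sobolevDensity k hq).const_mul αp).intervalIntegrable _ _
  · exact (continuous_energyDensity _ _ _ hq hq).intervalIntegrable _ _

theorem eqOn_zero_of_integral_le {f : ℝ → ℝ} (hf : Continuous f) (h0 : ∀ x, 0 ≤ f x) {a b : ℝ}
    (hab : a < b) (h : ∫ x in a..b, f x ≤ 0) : ∀ x ∈ Icc a b, f x = 0 := by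
  intro x hx
  by_contra hne
  have := intervalIntegral.integral_pos hab hf.continuousOn (fun y _ => h0 y)
    ⟨x, hx, lt_of_le_of_ne (h0 x) (Ne.symm hne)⟩
  linarith

theorem eqOn_zero_of_sobolev_le {αm αp k : ℝ} {p q : ℝ → ℝ} (hp : ContDiff ℝ ∞ p)
    (hq : ContDiff ℝ ∞ q) (hαm : 0 < αm) (hαp : 0 < αp) (h : sobolev αm αp k p q ≤ 0) :
    (∀ x ∈ Icc (-1 : ℝ) 0, k ^ 2 * p x ^ 2 + deriv p x ^ 2 = 0) ∧
      ∀ x ∈ Icc (0 : ℝ) 1, k ^ 2 * q x ^ 2 + deriv q x ^ 2 = 0 := by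
  have h1 : 0 ≤ ∫ x in (-1 : ℝ)..0, (k ^ 2 * p x ^ 2 + deriv p x ^ 2) :=
    intervalIntegral.integral_nonneg (by norm_num) fun x _ => by positivity
  have h2 : 0 ≤ ∫ x in (0 : ℝ)..1, (k ^ 2 * q x ^ 2 + deriv q x ^ 2) :=
    intervalIntegral.integral_nonneg (by norm_num) fun x _ => by positivity
  have h1' := mul_nonneg hαm.le h1
  have h2' := mul_nonneg hαp.le h2
  unfold sobolev at h
  refine ⟨eqOn_zero_of_integral_le (continuous_sobolevDensity k hp) (fun x => by positivity)
    (by norm_num) ?_, eqOn_zero_of_integral_le (continuous_sobolevDensity k hq)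
    (fun x => by positivity) (by norm_num) ?_⟩
  · by_contra hlt
    have := mul_pos hαm (not_le.1 hlt)
    linarith
  · by_contra hlt
    have := mul_pos hαp (not_le.1 hlt)
    linarith

/-! ### Solvability for a prescribed interface force. -/

/-- The general solution of the equation in one fluid, as a function of its coefficients. -/
def hyp (m k x : ℝ) : (Fin 4 → ℝ) →ₗ[ℝ] ℝ where
  toFun c := c 0 * Real.cosh (m * x) + c 1 * Real.sinh (m * x) + c 2 * Real.cosh (k * x) +
    c 3 * Real.sinh (k * x)
  map_add' c d := by simp only [Pi.add_apply]; ring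
  map_smul' s c := by simp only [Pi.smul_apply, smul_eq_mul, RingHom.id_apply]; ring

/-- The action of differentiation on the coefficients. -/
def hypDeriv (m k : ℝ) : (Fin 4 → ℝ) →ₗ[ℝ] (Fin 4 → ℝ) where
  toFun c := ![m * c 1, m * c 0, k * c 3, k * c 2]
  map_add' c d := by ext i; fin_cases i <;> simp <;> ring
  map_smul' s c := by ext i; fin_cases i <;> simp <;> ring

theorem deriv_hyp (m k : ℝ) (c : Fin 4 → ℝ) :
    deriv (fun x => hyp m k x c) = fun x => hyp m k x (hypDeriv m k c) := by
  funext x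
  have hm : HasDerivAt (fun x : ℝ => m * x) m x := by simpa using (hasDerivAt_id x).const_mul m
  have hk : HasDerivAt (fun x : ℝ => k * x) k x := by simpa using (hasDerivAt_id x).const_mul k
  have := (((hm.cosh.const_mul (c 0)).add (hm.sinh.const_mul (c 1))).add
    (hk.cosh.const_mul (c 2))).add (hk.sinh.const_mul (c 3))
  refine (this.congr_deriv ?_).deriv
  simp only [hyp, hypDeriv, LinearMap.coe_mk, AddHom.coe_mk]
  simp
  ring

theorem iteratedDeriv_hyp (m k : ℝ) (c : Fin 4 → ℝ) (n : ℕ) :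
    iteratedDeriv n (fun x => hyp m k x c) = fun x => hyp m k x ((hypDeriv m k ^ n) c) := by
  induction n with
  | zero => simp
  | succ n ih => rw [iteratedDeriv_succ, ih, deriv_hyp, pow_succ']; rfl

theorem contDiff_hyp (m k : ℝ) (c : Fin 4 → ℝ) : ContDiff ℝ ∞ (fun x => hyp m k x c) := by
  simp only [hyp, LinearMap.coe_mk, AddHom.coe_mk]
  fun_prop

/-- With `D` the differentiation, the operator factors as `ν(D² - k²)(D² - m²)` precisely under
`hm`. -/
theorem solvesODE_hyp {α ν k m : ℝ} (hm : ν * (m ^ 2 - k ^ 2) = α) (c : Fin 4 → ℝ) :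
    SolvesODE α ν k (fun x => hyp m k x c) := by
  intro x
  rw [iteratedDeriv_hyp, iteratedDeriv_hyp]
  simp only [hyp, hypDeriv, pow_succ, pow_zero, one_mul, Module.End.mul_apply, LinearMap.coe_mk,
    AddHom.coe_mk]
  simp
  subst hm
  ring

/-- The derivatives of orders `0` to `3` vanish at `x₀`. Since `m² ≠ k²` they separate the two
frequencies, and `cosh² - sinh² = 1` inverts each 2 by 2 block. -/
theorem hyp_eq_zero {m k : ℝ} (hk : k ≠ 0) (hm : m ≠ 0) (hmk : m ^ 2 ≠ k ^ 2) {c : Fin 4 → ℝ}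
    {x₀ : ℝ} (h : (fun x => hyp m k x c) =ᶠ[𝓝 x₀] fun _ => 0) : c = 0 := by
  have hd : ∀ n, hyp m k x₀ ((hypDeriv m k ^ n) c) = 0 := by
    intro n
    have := (h.iteratedDeriv n).eq_of_nhds
    rw [iteratedDeriv_hyp] at this
    simpa using this
  have h0 := hd 0
  have h1 := hd 1
  have h2 := hd 2
  have h3 := hd 3
  simp only [hyp, hypDeriv, pow_succ, pow_zero, one_mul, Module.End.mul_apply, LinearMap.coe_mk,
    AddHom.coe_mk, Module.End.one_apply] at h0 h1 h2 h3
  simp at h1 h2 h3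
  have em := Real.cosh_sq (m * x₀)
  have ek := Real.cosh_sq (k * x₀)
  generalize Real.cosh (m * x₀) = C at *
  generalize Real.sinh (m * x₀) = S at *
  generalize Real.cosh (k * x₀) = C' at *
  generalize Real.sinh (k * x₀) = S' at *
  have hne : m ^ 2 - k ^ 2 ≠ 0 := sub_ne_zero.2 hmk
  have x1 : c 0 * C + c 1 * S = 0 :=
    mul_left_cancel₀ hne (by linear_combination h2 - k ^ 2 * h0)
  have x2 : c 2 * C' + c 3 * S' = 0 := by linear_combination h0 - x1
  have x3 : c 0 * S + c 1 * C = 0 :=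
    mul_left_cancel₀ (mul_ne_zero hm hne) (by linear_combination h3 - k ^ 2 * h1)
  have x4 : c 2 * S' + c 3 * C' = 0 :=
    mul_left_cancel₀ hk (by linear_combination h1 - m * x3)
  ext i
  fin_cases i
  · change c 0 = 0
    linear_combination C * x1 - S * x3 - c 0 * em
  · change c 1 = 0
    linear_combination C * x3 - S * x1 - c 1 * em
  · change c 2 = 0
    linear_combination C' * x2 - S' * x4 - c 2 * ek
  · change c 3 = 0
    linear_combination C' * x4 - S' * x2 - c 3 * ek

/-- Every interface force has a response. -/
theorem exists_isResponse {αm αp νm νp k : ℝ} (hαm : 0 < αm) (hαp : 0 < αp) (hνm : 0 < νm)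
    (hνp : 0 < νp) (hk : 0 < k) (c : ℝ) : ∃ p q, IsResponse αm αp νm νp k c p q := by
  have hroot : ∀ {α ν : ℝ}, 0 < α → 0 < ν →
      ∃ m : ℝ, m ≠ 0 ∧ m ^ 2 ≠ k ^ 2 ∧ ν * (m ^ 2 - k ^ 2) = α := by
    intro α ν hα hν
    have hpos : 0 < k ^ 2 + α / ν := by positivity
    have hlt : 0 < α / ν := by positivity
    refine ⟨√(k ^ 2 + α / ν), (Real.sqrt_pos.2 hpos).ne', ?_, ?_⟩
    · rw [Real.sq_sqrt hpos.le]; linarith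
    · rw [Real.sq_sqrt hpos.le]; field_simp; ring
  obtain ⟨a, ha0, hak, ha⟩ := hroot hαm hνm
  obtain ⟨b, hb0, hbk, hb⟩ := hroot hαp hνp
  let P (x : ℝ) (n : ℕ) : (Fin 4 → ℝ) × (Fin 4 → ℝ) →ₗ[ℝ] ℝ :=
    (hyp a k x ∘ₗ (hypDeriv a k ^ n)) ∘ₗ LinearMap.fst ℝ _ _
  let Q (x : ℝ) (n : ℕ) : (Fin 4 → ℝ) × (Fin 4 → ℝ) →ₗ[ℝ] ℝ :=
    (hyp b k x ∘ₗ (hypDeriv b k ^ n)) ∘ₗ LinearMap.snd ℝ _ _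
  -- Eight coefficients against eight conditions: four at the walls, four at the interface, with the
  -- force entering only the last.
  let T : (Fin 4 → ℝ) × (Fin 4 → ℝ) →ₗ[ℝ] (Fin 8 → ℝ) := LinearMap.pi
    ![P (-1) 0, P (-1) 1, Q 1 0, Q 1 1, P 0 0 - Q 0 0, P 0 1 - Q 0 1,
      νp • (k ^ 2 • Q 0 0 + Q 0 2) - νm • (k ^ 2 • P 0 0 + P 0 2),
      νp • (Q 0 3 - (3 * k ^ 2) • Q 0 1) - νm • (P 0 3 - (3 * k ^ 2) • P 0 1) -
        (αp - αm) • Q 0 1]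
  have hT : ∀ u s, T u = ![0, 0, 0, 0, 0, 0, 0, s] →
      IsResponse αm αp νm νp k s (fun x => hyp a k x u.1) (fun x => hyp b k x u.2) := by
    intro u s hu
    have e : ∀ i, T u i = (![0, 0, 0, 0, 0, 0, 0, s] : Fin 8 → ℝ) i := fun i => congrFun hu i
    have e0 := e 0
    have e1 := e 1
    have e2 := e 2
    have e3 := e 3
    have e4 := e 4
    have e5 := e 5
    have e6 := e 6
    have e7 := e 7
    simp [T, P, Q] at e0 e1 e2 e3 e4 e5 e6 e7
    refine ⟨⟨contDiff_hyp _ _ _, contDiff_hyp _ _ _, e0, ?_, e2, ?_, ?_, ?_⟩,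
      solvesODE_hyp ha _, solvesODE_hyp hb _, ?_, ?_⟩
    · rw [deriv_hyp]; exact e1
    · rw [deriv_hyp]; exact e3
    · exact sub_eq_zero.1 e4
    · rw [deriv_hyp, deriv_hyp]; exact sub_eq_zero.1 e5
    · rw [iteratedDeriv_hyp, iteratedDeriv_hyp]; linear_combination e6
    · rw [iteratedDeriv_hyp, iteratedDeriv_hyp, deriv_hyp, deriv_hyp]
      linear_combination e7
  -- A kernel element is a response to zero force, so its energy is zero and it vanishes in both
  -- fluids.
  have hinj : Function.Injective T := by
    rw [injective_iff_map_eq_zero]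
    intro u hu
    have hR := hT u 0 (by rw [hu]; ext i; fin_cases i <;> rfl)
    have hE := hR.energy_eq hR.toAdmissible
    have hS := sobolev_le_energy (αm := αm) (αp := αp) k hR.smooth_lower hR.smooth_upper
      hνm.le hνp.le
    rw [hE, zero_mul] at hS
    obtain ⟨h1, h2⟩ := eqOn_zero_of_sobolev_le hR.smooth_lower hR.smooth_upper hαm hαp hS
    have hz : ∀ {y z : ℝ}, k ^ 2 * y ^ 2 + z ^ 2 = 0 → y = 0 := by
      intro y z h
      have : k ^ 2 * y ^ 2 = 0 := by nlinarith [sq_nonneg z, sq_nonneg (k * y)]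
      simpa [hk.ne'] using this
    refine Prod.ext (hyp_eq_zero hk.ne' ha0 hak (x₀ := -1 / 2) ?_)
      (hyp_eq_zero hk.ne' hb0 hbk (x₀ := 1 / 2) ?_)
    · filter_upwards [Icc_mem_nhds (show (-1 : ℝ) < -1 / 2 by norm_num)
        (show (-1 / 2 : ℝ) < 0 by norm_num)] with x hx
      exact hz (h1 x hx)
    · filter_upwards [Icc_mem_nhds (show (0 : ℝ) < 1 / 2 by norm_num)
        (show (1 / 2 : ℝ) < 1 by norm_num)] with x hx
      exact hz (h2 x hx)
  have hsurj := (LinearMap.injective_iff_surjective_of_finrank_eq_finrank (f := T)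
    (by simp)).1 hinj
  obtain ⟨u, hu⟩ := hsurj ![0, 0, 0, 0, 0, 0, 0, c]
  exact ⟨_, _, hT u c hu⟩

/-! ### Dependence of the response on the growth rate, and existence of a growing mode. -/

theorem energyDensity_sub_smul_nonneg {α ν : ℝ} (hα : 0 ≤ α) (hν : 0 ≤ ν) (k t : ℝ)
    (F χ : ℝ → ℝ) (x : ℝ) :
    0 ≤ energyDensity α ν k χ χ x - 2 * t * energyDensity α ν k F χ x +
      t ^ 2 * energyDensity α ν k F F x := by
  have : energyDensity α ν k χ χ x - 2 * t * energyDensity α ν k F χ x +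
      t ^ 2 * energyDensity α ν k F F x =
      α * (k ^ 2 * (χ x - t * F x) ^ 2 + (deriv χ x - t * deriv F x) ^ 2) +
      ν * (4 * k ^ 2 * (deriv χ x - t * deriv F x) ^ 2 +
        (iteratedDeriv 2 χ x + k ^ 2 * χ x - t * (iteratedDeriv 2 F x + k ^ 2 * F x)) ^ 2) := by
    unfold energyDensity; ring
  rw [this]
  positivity

/-- The right side is the energy of the difference `(χ,η) - t(p,q)`, expanded in `t`. -/
theorem energy_sub_smul_nonneg {αm αp νm νp : ℝ} (hαm : 0 ≤ αm) (hαp : 0 ≤ αp) (hνm : 0 ≤ νm)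
    (hνp : 0 ≤ νp) (k t : ℝ) {p q χ η : ℝ → ℝ} (h : Admissible p q) (hχ : Admissible χ η) :
    0 ≤ energy αm αp νm νp k χ η χ η - 2 * t * energy αm αp νm νp k p q χ η +
      t ^ 2 * energy αm αp νm νp k p q p q := by
  have key : ∀ {α ν : ℝ} {F ζ : ℝ → ℝ} {a b : ℝ}, 0 ≤ α → 0 ≤ ν → ContDiff ℝ ∞ F →
      ContDiff ℝ ∞ ζ → a ≤ b →
      0 ≤ (∫ x in a..b, energyDensity α ν k ζ ζ x) -
        2 * t * (∫ x in a..b, energyDensity α ν k F ζ x) +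
        t ^ 2 * ∫ x in a..b, energyDensity α ν k F F x := by
    intro α ν F ζ a b hα hν hF hζ hab
    have i1 := (continuous_energyDensity α ν k hζ hζ).intervalIntegrable a b (μ := volume)
    have i2 := (continuous_energyDensity α ν k hF hζ).intervalIntegrable a b (μ := volume)
    have i3 := (continuous_energyDensity α ν k hF hF).intervalIntegrable a b (μ := volume)
    rw [← intervalIntegral.integral_const_mul, ← intervalIntegral.integral_const_mul,
      ← intervalIntegral.integral_sub i1 (i2.const_mul _),
      ← intervalIntegral.integral_add (i1.sub (i2.const_mul _)) (i3.const_mul _)]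
    exact intervalIntegral.integral_nonneg hab fun x _ =>
      energyDensity_sub_smul_nonneg hα hν k t F ζ x
  have h1 := key (a := -1) (b := 0) hαm hνm h.smooth_lower hχ.smooth_lower (by norm_num)
  have h2 := key (a := 0) (b := 1) hαp hνp h.smooth_upper hχ.smooth_upper (by norm_num)
  unfold energy
  linarith

/-- The response to the unit force dominates the trace of every admissible pair. -/
theorem IsResponse.sq_le {αm αp νm νp k : ℝ} (hαm : 0 ≤ αm) (hαp : 0 ≤ αp) (hνm : 0 ≤ νm)
    (hνp : 0 ≤ νp) {p q χ η : ℝ → ℝ} (h : IsResponse αm αp νm νp k 1 p q)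
    (hχ : Admissible χ η) : η 0 ^ 2 ≤ q 0 * energy αm αp νm νp k χ η χ η := by
  -- Cauchy-Schwarz for the energy form: by `energy_eq` the response has self-energy `q 0` and mixed
  -- energy `η 0`.
  have := discrim_le_zero (a := q 0) (b := -2 * η 0) (c := energy αm αp νm νp k χ η χ η)
    (fun t => by
      have := energy_sub_smul_nonneg hαm hαp hνm hνp k t h.toAdmissible hχ
      rw [h.energy_eq hχ, h.energy_eq h.toAdmissible] at this
      linarith)
  unfold discrim at this
  linarith

theorem energy_le_mul_energy {αm αp νm νp αm' αp' νm' νp' s : ℝ} (h1 : αm' ≤ s * αm)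
    (h2 : αp' ≤ s * αp) (h3 : νm' ≤ s * νm) (h4 : νp' ≤ s * νp) (k : ℝ) {χ η : ℝ → ℝ}
    (hχ : Admissible χ η) :
    energy αm' αp' νm' νp' k χ η χ η ≤ s * energy αm αp νm νp k χ η χ η := by
  have key : ∀ {α ν α' ν' : ℝ} {ζ : ℝ → ℝ} {a b : ℝ}, α' ≤ s * α → ν' ≤ s * ν →
      ContDiff ℝ ∞ ζ → a ≤ b → ∫ x in a..b, energyDensity α' ν' k ζ ζ x ≤
        s * ∫ x in a..b, energyDensity α ν k ζ ζ x := by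
    intro α ν α' ν' ζ a b hα hν hζ hab
    have i1 := (continuous_energyDensity α' ν' k hζ hζ).intervalIntegrable a b (μ := volume)
    have i2 := (continuous_energyDensity α ν k hζ hζ).intervalIntegrable a b (μ := volume)
    rw [← intervalIntegral.integral_const_mul]
    refine intervalIntegral.integral_mono_on hab i1 (i2.const_mul s) fun x _ => ?_
    have e1 := mul_le_mul_of_nonneg_right hα
      (show 0 ≤ k ^ 2 * (ζ x * ζ x) + deriv ζ x * deriv ζ x from
        add_nonneg (mul_nonneg (sq_nonneg k) (mul_self_nonneg _)) (mul_self_nonneg _))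
    have e2 := mul_le_mul_of_nonneg_right hν
      (show 0 ≤ 4 * k ^ 2 * (deriv ζ x * deriv ζ x) +
        (iteratedDeriv 2 ζ x + k ^ 2 * ζ x) * (iteratedDeriv 2 ζ x + k ^ 2 * ζ x) from
        add_nonneg (mul_nonneg (by positivity) (mul_self_nonneg _)) (mul_self_nonneg _))
    unfold energyDensity
    linarith
  have e1 := key (a := -1) (b := 0) h1 h3 hχ.smooth_lower (by norm_num)
  have e2 := key (a := 0) (b := 1) h2 h4 hχ.smooth_upper (by norm_num)
  unfold energy
  linarith

/-- If `h` decreases and `x² h(x)` increases on `(0,∞)`, then `h` is continuous there. -/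
theorem continuousOn_of_antitone_of_sq_mul_monotone {h : ℝ → ℝ}
    (h1 : ∀ x y, 0 < x → x ≤ y → h y ≤ h x)
    (h2 : ∀ x y, 0 < x → x ≤ y → h x ≤ (y / x) ^ 2 * h y) : ContinuousOn h (Ioi 0) := by
  intro a ha
  have ha : 0 < a := ha
  refine ContinuousAt.continuousWithinAt ?_
  have hlim : Tendsto (fun x => (a / x) ^ 2 * h a) (𝓝 a) (𝓝 (h a)) := by
    have : ContinuousAt (fun x => (a / x) ^ 2 * h a) a :=
      ((continuousAt_const.div continuousAt_id ha.ne').pow 2).mul continuousAt_const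
    simpa [ContinuousAt, ha.ne'] using this
  -- On either side of `a`, the value `h x` lies between `h a` and `(a/x)² h a`; minimum and maximum
  -- cover both orders at once.
  have hmin := (tendsto_const_nhds (x := h a) (f := 𝓝 a)).min hlim
  have hmax := (tendsto_const_nhds (x := h a) (f := 𝓝 a)).max hlim
  rw [min_self] at hmin
  rw [max_self] at hmax
  refine tendsto_of_tendsto_of_tendsto_of_le_of_le' hmin hmax ?_ ?_
  · filter_upwards [lt_mem_nhds ha] with x hx
    rcases le_total a x with hax | hax
    · refine (min_le_right _ _).trans ?_
      have := mul_le_mul_of_nonneg_left (h2 a x ha hax) (sq_nonneg (a / x))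
      rwa [← mul_assoc, ← mul_pow, div_mul_div_cancel₀ hx.ne', div_self ha.ne', one_pow,
        one_mul] at this
    · exact (min_le_left _ _).trans (h1 x a hx hax)
  · filter_upwards [lt_mem_nhds ha] with x hx
    rcases le_total a x with hax | hax
    · exact (h1 a x ha hax).trans (le_max_left _ _)
    · exact (h2 x a hx hax).trans (le_max_right _ _)

/-- Integrate `-2kηη' ≤ k²η² + η'²`, whose left side is the derivative of `-kη²`. This bounds the
response from above for large growth rates. -/
theorem mul_sq_apply_zero_le {η : ℝ → ℝ} (hη : ContDiff ℝ ∞ η) (h1 : η 1 = 0) (k : ℝ) :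
    k * η 0 ^ 2 ≤ ∫ x in (0 : ℝ)..1, (k ^ 2 * η x ^ 2 + deriv η x ^ 2) := by
  have hc := hη.continuous
  have hd := continuous_deriv_of_smooth hη
  have hi : Continuous (fun x => -k * (2 * η x * deriv η x)) := by fun_prop
  have : ∫ x in (0 : ℝ)..1, -k * (2 * η x * deriv η x) = -k * η 1 ^ 2 - -k * η 0 ^ 2 := by
    refine intervalIntegral.integral_eq_sub_of_hasDerivAt (f := fun x => -k * η x ^ 2)
      (fun x _ => ?_) (hi.intervalIntegrable _ _)
    have := ((hasDerivAt_self hη x).pow 2).const_mul (-k)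
    exact this.congr_deriv (by simp)
  rw [h1] at this
  have h2 : ∫ x in (0 : ℝ)..1, -k * (2 * η x * deriv η x) ≤
      ∫ x in (0 : ℝ)..1, (k ^ 2 * η x ^ 2 + deriv η x ^ 2) :=
    intervalIntegral.integral_mono_on (by norm_num) (hi.intervalIntegrable _ _)
      ((continuous_sobolevDensity k hη).intervalIntegrable _ _) fun x _ => by
        nlinarith [sq_nonneg (k * η x + deriv η x)]
  rw [this] at h2
  linarith

/-- Inertia, viscosity and magnetic tension carry the powers `l²`, `l` and `1`, so the magnetic part
alone remains as `l → 0`. -/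
theorem energy_eq_expansion (ρm ρp μm μp β k l : ℝ) {χ η : ℝ → ℝ} (hχ : Admissible χ η) :
    energy (l ^ 2 * ρm + β) (l ^ 2 * ρp + β) (l * μm) (l * μp) k χ η χ η =
      l ^ 2 * energy ρm ρp 0 0 k χ η χ η + l * energy 0 0 μm μp k χ η χ η +
        sobolev β β k χ η := by
  have key : ∀ {ρ μ : ℝ} {ζ : ℝ → ℝ} {a b : ℝ}, ContDiff ℝ ∞ ζ →
      ∫ x in a..b, energyDensity (l ^ 2 * ρ + β) (l * μ) k ζ ζ x =
        l ^ 2 * (∫ x in a..b, energyDensity ρ 0 k ζ ζ x) +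
          l * (∫ x in a..b, energyDensity 0 μ k ζ ζ x) +
          β * ∫ x in a..b, (k ^ 2 * ζ x ^ 2 + deriv ζ x ^ 2) := by
    intro ρ μ ζ a b hζ
    have i1 := ((continuous_energyDensity ρ 0 k hζ hζ).intervalIntegrable a b
      (μ := volume)).const_mul (l ^ 2)
    have i2 := ((continuous_energyDensity 0 μ k hζ hζ).intervalIntegrable a b
      (μ := volume)).const_mul l
    have i3 := ((continuous_sobolevDensity k hζ).intervalIntegrable a b
      (μ := volume)).const_mul β
    rw [← intervalIntegral.integral_const_mul, ← intervalIntegral.integral_const_mul,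
      ← intervalIntegral.integral_const_mul, ← intervalIntegral.integral_add i1 i2,
      ← intervalIntegral.integral_add (i1.add i2) i3]
    congr 1
    funext x
    unfold energyDensity
    ring
  unfold energy sobolev
  rw [key hχ.smooth_lower, key hχ.smooth_upper]
  ring

/-- Existence of a growing mode, as the response that reproduces its own interface force. -/
theorem exists_growth_rate {ρm ρp μm μp β k G : ℝ} (hρm : 0 < ρm) (hρp : 0 < ρp) (hμm : 0 < μm)
    (hμp : 0 < μp) (hβ : 0 < β) (hk : 0 < k) (hG : 0 < G) {χ η : ℝ → ℝ} (hχ : Admissible χ η)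
    (hlt : sobolev β β k χ η < G * η 0 ^ 2) :
    ∃ l : ℝ, 0 < l ∧ ∃ p q, IsResponse (l ^ 2 * ρm + β) (l ^ 2 * ρp + β) (l * μm) (l * μp) k 1 p q
      ∧ G * q 0 = 1 := by
  have hex : ∀ l : ℝ, ∃ p q : ℝ → ℝ, 0 < l →
      IsResponse (l ^ 2 * ρm + β) (l ^ 2 * ρp + β) (l * μm) (l * μp) k 1 p q := by
    intro l
    by_cases hl : 0 < l
    · obtain ⟨p, q, h⟩ := exists_isResponse (αm := l ^ 2 * ρm + β) (αp := l ^ 2 * ρp + β)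
        (νm := l * μm) (νp := l * μp) (by positivity) (by positivity) (by positivity)
        (by positivity) hk 1
      exact ⟨p, q, fun _ => h⟩
    · exact ⟨0, 0, fun h => absurd h hl⟩
  choose p q hpq using hex
  have hE : ∀ l, 0 < l → energy (l ^ 2 * ρm + β) (l ^ 2 * ρp + β) (l * μm) (l * μp) k
      (p l) (q l) (p l) (q l) = q l 0 := fun l hl => by
    rw [(hpq l hl).energy_eq (hpq l hl).toAdmissible, one_mul]
  have hCS : ∀ l, 0 < l → ∀ {χ η : ℝ → ℝ}, Admissible χ η → η 0 ^ 2 ≤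
      q l 0 * energy (l ^ 2 * ρm + β) (l ^ 2 * ρp + β) (l * μm) (l * μp) k χ η χ η :=
    fun l hl _ _ h => (hpq l hl).sq_le (by positivity) (by positivity) (by positivity)
      (by positivity) h
  -- The self-energy `q l 0` is at least the inertial energy of the upper fluid, which controls the
  -- trace.
  have hge : ∀ l, 0 < l → l ^ 2 * ρp * k * q l 0 ^ 2 ≤ q l 0 := by
    intro l hl
    have h := hpq l hl
    have h1 := sobolev_le_energy (αm := l ^ 2 * ρm + β) (αp := l ^ 2 * ρp + β) (νm := l * μm)
      (νp := l * μp) k h.smooth_lower h.smooth_upper (by positivity) (by positivity)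
    rw [hE l hl] at h1
    have h2 := mul_sq_apply_zero_le h.smooth_upper h.right k
    have h3 : 0 ≤ ∫ x in (-1 : ℝ)..0, (k ^ 2 * p l x ^ 2 + deriv (p l) x ^ 2) :=
      intervalIntegral.integral_nonneg (by norm_num) fun x _ => by positivity
    have h4 : 0 ≤ (l ^ 2 * ρm + β) * ∫ x in (-1 : ℝ)..0, (k ^ 2 * p l x ^ 2 + deriv (p l) x ^ 2) :=
      mul_nonneg (by positivity) h3
    have h5 := mul_le_mul_of_nonneg_left h2 (show 0 ≤ l ^ 2 * ρp + β by positivity)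
    have h6 : 0 ≤ β * (k * q l 0 ^ 2) := by positivity
    unfold sobolev at h1
    linarith
  have hnn : ∀ l, 0 < l → 0 ≤ q l 0 := fun l hl => le_trans (by positivity) (hge l hl)
  -- Test the Cauchy-Schwarz bound at `x` with the response at `y`, whose energy at the smaller rate
  -- is no larger; then divide by `q y 0`.
  have hanti : ∀ x y, 0 < x → x ≤ y → q y 0 ≤ q x 0 := by
    intro x y hx hxy
    have hy := hx.trans_le hxy
    have hsq : x ^ 2 ≤ y ^ 2 := by gcongr
    have h1 := hCS x hx (hpq y hy).toAdmissible
    have h2 := energy_le_mul_energy (αm := y ^ 2 * ρm + β) (αp := y ^ 2 * ρp + β)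
      (νm := y * μm) (νp := y * μp) (αm' := x ^ 2 * ρm + β) (αp' := x ^ 2 * ρp + β)
      (νm' := x * μm) (νp' := x * μp) (s := 1) (by rw [one_mul]; gcongr) (by rw [one_mul]; gcongr)
      (by rw [one_mul]; gcongr) (by rw [one_mul]; gcongr) k (hpq y hy).toAdmissible
    rw [hE y hy, one_mul] at h2
    have h3 := mul_le_mul_of_nonneg_left h2 (hnn x hx)
    rcases (hnn y hy).eq_or_lt with h0 | hpos
    · rw [← h0]; exact hnn x hx
    · refine le_of_mul_le_mul_right ?_ hpos
      linarith
  -- The roles are exchanged: since `y / x ≥ 1`, passing from `x` to `y` multiplies every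
  -- coefficient by at most `(y/x)²`.
  have hmono : ∀ x y, 0 < x → x ≤ y → q x 0 ≤ (y / x) ^ 2 * q y 0 := by
    intro x y hx hxy
    have hy := hx.trans_le hxy
    have h1 := hCS y hy (hpq x hx).toAdmissible
    have hr : 1 ≤ y / x := (one_le_div hx).2 hxy
    have hyx : y = y / x * x := by field_simp
    set r := y / x
    have hr2 : r ≤ r ^ 2 := by nlinarith
    have ha : ∀ ρ : ℝ, y ^ 2 * ρ + β ≤ r ^ 2 * (x ^ 2 * ρ + β) := by
      intro ρ
      have : β ≤ r ^ 2 * β := le_mul_of_one_le_left hβ.le (by nlinarith)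
      rw [hyx]
      nlinarith
    have hb : ∀ μ : ℝ, 0 < μ → y * μ ≤ r ^ 2 * (x * μ) := by
      intro μ hμ
      have := mul_le_mul_of_nonneg_right hr2 (show 0 ≤ x * μ by positivity)
      rw [hyx]
      linarith
    have h2 := energy_le_mul_energy (ha ρm) (ha ρp) (hb μm hμm) (hb μp hμp) k
      (hpq x hx).toAdmissible
    rw [hE x hx] at h2
    have h3 := mul_le_mul_of_nonneg_left h2 (hnn y hy)
    rcases (hnn x hx).eq_or_lt with h0 | hpos
    · rw [← h0]; exact mul_nonneg (by positivity) (hnn y hy)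
    · refine le_of_mul_le_mul_right ?_ hpos
      linarith
  have hcont : ContinuousOn (fun l => G * q l 0) (Ioi 0) :=
    continuousOn_const.mul
      (continuousOn_of_antitone_of_sq_mul_monotone (h := fun l => q l 0) hanti hmono)
  obtain ⟨a, ha1, ha⟩ : ∃ a : ℝ, energy (a ^ 2 * ρm + β) (a ^ 2 * ρp + β) (a * μm) (a * μp) k
      χ η χ η < G * η 0 ^ 2 ∧ 0 < a := by
    have hc : Tendsto (fun l : ℝ => l ^ 2 * energy ρm ρp 0 0 k χ η χ η +
        l * energy 0 0 μm μp k χ η χ η + sobolev β β k χ η) (𝓝[>] 0)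
        (𝓝 (0 ^ 2 * energy ρm ρp 0 0 k χ η χ η +
        0 * energy 0 0 μm μp k χ η χ η + sobolev β β k χ η)) :=
      tendsto_nhdsWithin_of_tendsto_nhds (Continuous.tendsto (by fun_prop) _)
    obtain ⟨a, h1, h2⟩ :=
      ((hc.eventually_lt_const (by simpa using hlt)).and self_mem_nhdsWithin).exists
    exact ⟨a, by rwa [energy_eq_expansion ρm ρp μm μp β k a hχ], h2⟩
  have hGa : 1 ≤ G * q a 0 := by
    have h1 := hCS a ha hχ
    have h2 := mul_le_mul_of_nonneg_left ha1.le (hnn a ha)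
    have hpos : 0 < η 0 ^ 2 := by
      have h0 : 0 ≤ sobolev β β k χ η := by
        unfold sobolev
        have h1 : 0 ≤ ∫ x in (-1 : ℝ)..0, (k ^ 2 * χ x ^ 2 + deriv χ x ^ 2) :=
          intervalIntegral.integral_nonneg (by norm_num) fun x _ => by positivity
        have h2 : 0 ≤ ∫ x in (0 : ℝ)..1, (k ^ 2 * η x ^ 2 + deriv η x ^ 2) :=
          intervalIntegral.integral_nonneg (by norm_num) fun x _ => by positivity
        positivity
      by_contra hle
      have := mul_nonpos_of_nonneg_of_nonpos hG.le (not_lt.1 hle)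
      linarith
    refine le_of_mul_le_mul_right ?_ hpos
    linarith
  obtain ⟨b, hb, hGb⟩ : ∃ b : ℝ, 0 < b ∧ G * q b 0 ≤ 1 := by
    have hpos : 0 < G / (ρp * k) := by positivity
    -- This `b` solves `b² ρp k = G`, so `hge` reads `G q² ≤ q`.
    refine ⟨√(G / (ρp * k)), Real.sqrt_pos.2 hpos, ?_⟩
    have hb := Real.sqrt_pos.2 hpos
    have h1 := hge _ hb
    have h2 : √(G / (ρp * k)) ^ 2 * ρp * k = G := by
      rw [Real.sq_sqrt hpos.le]; field_simp
    rw [h2] at h1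
    rcases (hnn _ hb).eq_or_lt with h0 | hq
    · rw [← h0]; simp
    · refine le_of_mul_le_mul_right ?_ hq
      linarith
  obtain ⟨l, hl, hGl⟩ := isPreconnected_Ioi.intermediate_value (mem_Ioi.2 hb) (mem_Ioi.2 ha)
    hcont ⟨hGb, hGa⟩
  exact ⟨l, hl, p l, q l, hpq l hl, hGl⟩

/-! ### Smooth extension of classical solutions across the interface and the walls. -/

theorem exists_eq_mul_exp {f : ℝ → ℝ} {a b c : ℝ}
    (h : ∀ x ∈ Ioo a b, HasDerivAt f (c * f x) x) :
    ∃ C : ℝ, ∀ x ∈ Ioo a b, f x = C * Real.exp (c * x) := by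
  have hd : ∀ x ∈ Ioo a b, HasDerivAt (fun x => f x * Real.exp (-(c * x))) 0 x := by
    intro x hx
    have he : HasDerivAt (fun x => Real.exp (-(c * x))) (Real.exp (-(c * x)) * -c) x := by
      have : HasDerivAt (fun x : ℝ => -(c * x)) (-c) x := by
        simpa using ((hasDerivAt_id x).const_mul c).fun_neg
      exact this.exp
    exact ((h x hx).mul he).congr_deriv (by ring)
  obtain ⟨C, hC⟩ := isOpen_Ioo.exists_is_const_of_deriv_eq_zero isPreconnected_Ioo
    (fun x hx => (hd x hx).differentiableAt.differentiableWithinAt) (fun x hx => (hd x hx).deriv)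
  refine ⟨C, fun x hx => ?_⟩
  rw [← hC x hx, mul_assoc, ← Real.exp_add]
  simp

/-- Solutions of `f'' = κ² f` on an interval extend to global smooth solutions. -/
theorem exists_extension_of_second_order {f f' : ℝ → ℝ} {a b κ : ℝ}
    (h1 : ∀ x ∈ Ioo a b, HasDerivAt f (f' x) x)
    (h2 : ∀ x ∈ Ioo a b, HasDerivAt f' (κ ^ 2 * f x) x) :
    ∃ F F' : ℝ → ℝ, ContDiff ℝ ∞ F ∧ (∀ x, HasDerivAt F (F' x) x) ∧
      (∀ x, HasDerivAt F' (κ ^ 2 * F x) x) ∧ EqOn f F (Ioo a b) := by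
  -- The degenerate case occurs for the frequency `ξ = 0`, where the solutions are affine.
  rcases eq_or_ne κ 0 with rfl | hκ
  · obtain ⟨C, hC⟩ := exists_eq_mul_exp (c := 0) (f := f') (a := a) (b := b) fun x hx => by
      simpa using h2 x hx
    obtain ⟨D, hD⟩ := exists_eq_mul_exp (c := 0) (f := fun x => f x - C * x) (a := a) (b := b)
      fun x hx => by
        refine ((h1 x hx).sub ((hasDerivAt_id x).const_mul C)).congr_deriv ?_
        simp [hC x hx]
    refine ⟨fun x => C * x + D, fun _ => C, by fun_prop, fun x => ?_, fun x => ?_, fun x hx => ?_⟩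
    · simpa using ((hasDerivAt_id x).const_mul C).add_const D
    · simpa using hasDerivAt_const x C
    · have := hD x hx
      simp at this
      change f x = C * x + D
      linarith
  -- The combinations `f' ± κf` decouple the equation into two of first order.
  · obtain ⟨C, hC⟩ := exists_eq_mul_exp (c := κ) (f := fun x => f' x + κ * f x) (a := a) (b := b)
      fun x hx => ((h2 x hx).add ((h1 x hx).const_mul κ)).congr_deriv (by ring)
    obtain ⟨D, hD⟩ := exists_eq_mul_exp (c := -κ) (f := fun x => f' x - κ * f x) (a := a) (b := b)
      fun x hx => ((h2 x hx).sub ((h1 x hx).const_mul κ)).congr_deriv (by ring)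
    have he : ∀ s x : ℝ, HasDerivAt (fun x => Real.exp (s * x)) (Real.exp (s * x) * s) x := by
      intro s x
      have : HasDerivAt (fun x : ℝ => s * x) s x := by simpa using (hasDerivAt_id x).const_mul s
      exact this.exp
    refine ⟨fun x => (C / (2 * κ)) * Real.exp (κ * x) - (D / (2 * κ)) * Real.exp (-κ * x),
      fun x => (C / 2) * Real.exp (κ * x) + (D / 2) * Real.exp (-κ * x), by fun_prop,
      fun x => ?_, fun x => ?_, fun x hx => ?_⟩
    · refine (((he κ x).const_mul _).sub ((he (-κ) x).const_mul _)).congr_deriv ?_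
      field_simp
      ring
    · refine (((he κ x).const_mul _).add ((he (-κ) x).const_mul _)).congr_deriv ?_
      field_simp
      ring
    · have e1 := hC x hx
      have e2 := hD x hx
      simp only at e1 e2 ⊢
      rw [neg_mul] at e2
      field_simp
      linear_combination e1 - e2

theorem hasDerivAt_iteratedDeriv_of_contDiffOn {f : ℝ → ℝ} {s : Set ℝ} (hs : IsOpen s) {n m : ℕ}
    (hf : ContDiffOn ℝ n f s) (hm : m < n) {x : ℝ} (hx : x ∈ s) :
    HasDerivAt (iteratedDeriv m f) (iteratedDeriv (m + 1) f x) x := by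
  rw [iteratedDeriv_succ]
  have h1 := hf.differentiableOn_iteratedDerivWithin (m := m) (by exact_mod_cast hm)
    hs.uniqueDiffOn
  have h2 := h1.congr fun y hy => (iteratedDerivWithin_of_isOpen hs hy).symm
  exact ((h2 x hx).differentiableAt (hs.mem_nhds hx)).hasDerivAt

/-- Solutions of the fourth-order equation on an interval extend to global smooth solutions. -/
theorem exists_extension_of_ode {α ν k a b : ℝ} (hα : 0 < α) (hν : 0 < ν) {ψ : ℝ → ℝ}
    (hψ : ContDiffOn ℝ 4 ψ (Ioo a b))
    (ho : ∀ x ∈ Ioo a b,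
      ν * (k ^ 4 * ψ x - 2 * k ^ 2 * iteratedDeriv 2 ψ x + iteratedDeriv 4 ψ x) +
        α * (k ^ 2 * ψ x - iteratedDeriv 2 ψ x) = 0) :
    ∃ F : ℝ → ℝ, ContDiff ℝ ∞ F ∧ SolvesODE α ν k F ∧ EqOn ψ F (Ioo a b) := by
  have hd : ∀ m < 4, ∀ x ∈ Ioo a b,
      HasDerivAt (iteratedDeriv m ψ) (iteratedDeriv (m + 1) ψ x) x := fun m hm x hx =>
    hasDerivAt_iteratedDeriv_of_contDiffOn isOpen_Ioo (n := 4) (by exact_mod_cast hψ) hm hx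
  have hd0 : ∀ x ∈ Ioo a b, HasDerivAt ψ (iteratedDeriv 1 ψ x) x := fun x hx => by
    simpa using hd 0 (by norm_num) x hx
  set m := √(k ^ 2 + α / ν)
  have hm : m ^ 2 = k ^ 2 + α / ν := Real.sq_sqrt (by positivity)
  -- By the factorization, `ψ'' - k²ψ` solves `U'' = m²U`.
  obtain ⟨U, U', hU, hU1, hU2, hUe⟩ := exists_extension_of_second_order (a := a) (b := b) (κ := m)
    (f := fun x => iteratedDeriv 2 ψ x - k ^ 2 * ψ x)
    (f' := fun x => iteratedDeriv 3 ψ x - k ^ 2 * iteratedDeriv 1 ψ x)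
    (fun x hx => (hd 2 (by norm_num) x hx).sub ((hd0 x hx).const_mul _))
    (fun x hx => by
      refine ((hd 3 (by norm_num) x hx).sub
        ((hd 1 (by norm_num) x hx).const_mul (k ^ 2))).congr_deriv ?_
      rw [hm]
      have := ho x hx
      field_simp
      linear_combination this)
  -- Since `m² - k² = α/ν`, subtracting `(ν/α)U` from `ψ` removes the `m`-component and leaves a
  -- solution of `W'' = k²W`.
  obtain ⟨W, W', hW, hW1, hW2, hWe⟩ := exists_extension_of_second_order (a := a) (b := b) (κ := k)
    (f := fun x => ψ x - ν / α * U x) (f' := fun x => iteratedDeriv 1 ψ x - ν / α * U' x)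
    (fun x hx => (hd0 x hx).sub ((hU1 x).const_mul _))
    (fun x hx => by
      refine ((hd 1 (by norm_num) x hx).sub ((hU2 x).const_mul _)).congr_deriv ?_
      rw [hm, ← hUe hx]
      field_simp
      ring)
  have d1 : deriv (fun x => W x + ν / α * U x) = fun x => W' x + ν / α * U' x :=
    funext fun x => ((hW1 x).add ((hU1 x).const_mul _)).deriv
  have d2 : deriv (fun x => W' x + ν / α * U' x) =
      fun x => k ^ 2 * W x + ν / α * (m ^ 2 * U x) :=
    funext fun x => ((hW2 x).add ((hU2 x).const_mul _)).deriv
  have d3 : deriv (fun x => k ^ 2 * W x + ν / α * (m ^ 2 * U x)) =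
      fun x => k ^ 2 * W' x + ν / α * (m ^ 2 * U' x) :=
    funext fun x => (((hW1 x).const_mul _).add (((hU1 x).const_mul _).const_mul _)).deriv
  have d4 : deriv (fun x => k ^ 2 * W' x + ν / α * (m ^ 2 * U' x)) =
      fun x => k ^ 2 * (k ^ 2 * W x) + ν / α * (m ^ 2 * (m ^ 2 * U x)) :=
    funext fun x => (((hW2 x).const_mul _).add (((hU2 x).const_mul _).const_mul _)).deriv
  refine ⟨fun x => W x + ν / α * U x, hW.add (contDiff_const.mul hU), fun x => ?_, fun x hx => ?_⟩
  · simp only [iteratedDeriv_succ, iteratedDeriv_zero, d1, d2, d3, d4]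
    simp only [hm]
    field_simp
    ring
  · have := hWe hx
    simp only at this ⊢
    linarith

/-! ### Normal modes as responses. -/

theorem tendsto_nhdsGT_of_eqOn {f F : ℝ → ℝ} {a b : ℝ} (h : EqOn f F (Ioo a b)) (hab : a < b)
    (hF : Continuous F) : Tendsto f (𝓝[>] a) (𝓝 (F a)) := by
  refine Tendsto.congr' ?_ (hF.continuousWithinAt (s := Ioi a) (x := a)).tendsto
  filter_upwards [Ioo_mem_nhdsGT hab] with x hx using (h hx).symm

theorem tendsto_nhdsLT_of_eqOn {f F : ℝ → ℝ} {a b : ℝ} (h : EqOn f F (Ioo a b)) (hab : a < b)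
    (hF : Continuous F) : Tendsto f (𝓝[<] b) (𝓝 (F b)) := by
  refine Tendsto.congr' ?_ (hF.continuousWithinAt (s := Iio b) (x := b)).tendsto
  filter_upwards [Ioo_mem_nhdsLT hab] with x hx using (h hx).symm

theorem hasJump_iff {f fm fp : ℝ → ℝ} {J : ℝ} (hm : EqOn f fm (Ioo (-1) 0))
    (hp : EqOn f fp (Ioo 0 1)) (cm : Continuous fm) (cp : Continuous fp) :
    HasJump f J ↔ J = fp 0 - fm 0 := by
  have tp := tendsto_nhdsGT_of_eqOn hp one_pos cp
  have tm := tendsto_nhdsLT_of_eqOn hm (by norm_num) cm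
  constructor
  · rintro ⟨a, b, ha, hb, rfl⟩
    rw [tendsto_nhds_unique ha tp, tendsto_nhds_unique hb tm]
  · exact fun h => ⟨_, _, tp, tm, h⟩

theorem iteratedDeriv_eqOn {f F : ℝ → ℝ} {s : Set ℝ} (hs : IsOpen s) (h : EqOn f F s)
    (n : ℕ) : EqOn (iteratedDeriv n f) (iteratedDeriv n F) s := fun _ hx =>
  ((h.eventuallyEq_of_mem (hs.mem_nhds hx)).iteratedDeriv n).eq_of_nhds

theorem twoPhase_of_pos {a b x : ℝ} (hx : x ∈ Ioo (0 : ℝ) 1) : twoPhase a b x = a :=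
  if_pos hx.1

theorem twoPhase_of_neg {a b x : ℝ} (hx : x ∈ Ioo (-1 : ℝ) 0) : twoPhase a b x = b :=
  if_neg (not_lt.2 hx.2.le)

/-- Normal modes are the glued responses to the interface force `g[ρ]|ξ|²ψ(0)`. -/
theorem isNormalMode_iff_isResponse {g ρp ρm μp μm B ξ l : ℝ} {p q ψ : ℝ → ℝ}
    (hp : ContDiff ℝ ∞ p) (hq : ContDiff ℝ ∞ q)
    (hop : SolvesODE (l ^ 2 * ρm + |B| ^ 2 * |ξ| ^ 2) (l * μm) |ξ| p)
    (hoq : SolvesODE (l ^ 2 * ρp + |B| ^ 2 * |ξ| ^ 2) (l * μp) |ξ| q)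
    (hψp : EqOn ψ p (Icc (-1) 0)) (hψq : EqOn ψ q (Icc 0 1)) :
    IsNormalMode g ρp ρm μp μm B ξ l ψ ↔
      IsResponse (l ^ 2 * ρm + |B| ^ 2 * |ξ| ^ 2) (l ^ 2 * ρp + |B| ^ 2 * |ξ| ^ 2) (l * μm)
        (l * μp) |ξ| (g * (ρp - ρm) * |ξ| ^ 2 * ψ 0) p q := by
  have em : EqOn ψ p (Ioo (-1) 0) := hψp.mono Ioo_subset_Icc_self
  have ep : EqOn ψ q (Ioo 0 1) := hψq.mono Ioo_subset_Icc_self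
  have dm := iteratedDeriv_eqOn isOpen_Ioo em
  have dp := iteratedDeriv_eqOn isOpen_Ioo ep
  have dm1 : EqOn (deriv ψ) (deriv p) (Ioo (-1) 0) := by simpa using dm 1
  have dp1 : EqOn (deriv ψ) (deriv q) (Ioo 0 1) := by simpa using dp 1
  have hp0 : p 0 = ψ 0 := (hψp (by simp)).symm
  have hq0 : q 0 = ψ 0 := (hψq (by simp)).symm
  have cp := hp.continuous
  have cq := hq.continuous
  have cp1 := continuous_deriv_of_smooth hp
  have cq1 := continuous_deriv_of_smooth hq
  have cp2 := continuous_iteratedDeriv_of_smooth hp 2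
  have cq2 := continuous_iteratedDeriv_of_smooth hq 2
  have cp3 := continuous_iteratedDeriv_of_smooth hp 3
  have cq3 := continuous_iteratedDeriv_of_smooth hq 3
  have j1 : ∀ J, HasJump (deriv ψ) J ↔ J = deriv q 0 - deriv p 0 := fun J =>
    hasJump_iff dm1 dp1 cp1 cq1
  have j2 : ∀ J, HasJump
      (fun x => twoPhase μp μm x * l * (|ξ| ^ 2 * ψ x + iteratedDeriv 2 ψ x)) J ↔
      J = μp * l * (|ξ| ^ 2 * q 0 + iteratedDeriv 2 q 0) -
        μm * l * (|ξ| ^ 2 * p 0 + iteratedDeriv 2 p 0) := fun J =>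
    hasJump_iff (fm := fun x => μm * l * (|ξ| ^ 2 * p x + iteratedDeriv 2 p x))
      (fp := fun x => μp * l * (|ξ| ^ 2 * q x + iteratedDeriv 2 q x))
      (fun x hx => by simp only [twoPhase_of_neg hx, em hx, dm 2 hx])
      (fun x hx => by simp only [twoPhase_of_pos hx, ep hx, dp 2 hx])
      (by fun_prop) (by fun_prop)
  have j3 : ∀ J, HasJump (fun x => l ^ 2 * twoPhase ρp ρm x * deriv ψ x) J ↔
      J = l ^ 2 * ρp * deriv q 0 - l ^ 2 * ρm * deriv p 0 := fun J =>
    hasJump_iff (fm := fun x => l ^ 2 * ρm * deriv p x) (fp := fun x => l ^ 2 * ρp * deriv q x)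
      (fun x hx => by simp only [twoPhase_of_neg hx, dm1 hx])
      (fun x hx => by simp only [twoPhase_of_pos hx, dp1 hx])
      (by fun_prop) (by fun_prop)
  have j4 : ∀ J, HasJump
      (fun x => twoPhase μp μm x * l * (iteratedDeriv 3 ψ x - 3 * |ξ| ^ 2 * deriv ψ x)) J ↔
      J = μp * l * (iteratedDeriv 3 q 0 - 3 * |ξ| ^ 2 * deriv q 0) -
        μm * l * (iteratedDeriv 3 p 0 - 3 * |ξ| ^ 2 * deriv p 0) := fun J =>
    hasJump_iff (fm := fun x => μm * l * (iteratedDeriv 3 p x - 3 * |ξ| ^ 2 * deriv p x))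
      (fp := fun x => μp * l * (iteratedDeriv 3 q x - 3 * |ξ| ^ 2 * deriv q x))
      (fun x hx => by simp only [twoPhase_of_neg hx, dm1 hx, dm 3 hx])
      (fun x hx => by simp only [twoPhase_of_pos hx, dp1 hx, dp 3 hx])
      (by fun_prop) (by fun_prop)
  have tl := tendsto_nhdsGT_of_eqOn dm1 (by norm_num) cp1
  have tr := tendsto_nhdsLT_of_eqOn dp1 (by norm_num) cq1
  constructor
  · intro h
    have e1 := (j1 _).1 h.jump_deriv
    have e2 := (j2 _).1 h.jump_two
    obtain ⟨J, hJ, h3⟩ := h.jump_three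
    have e3 := (j3 _).1 hJ
    have e4 := (j4 _).1 h3
    have e5 : deriv p 0 = deriv q 0 := by linarith
    refine ⟨⟨hp, hq, ?_, tendsto_nhds_unique tl h.deriv_left, ?_,
      tendsto_nhds_unique tr h.deriv_right, hp0.trans hq0.symm, e5⟩, hop, hoq, ?_, ?_⟩
    · rw [← hψp (by simp), h.left]
    · rw [← hψq (by simp), h.right]
    · linear_combination -e2
    -- The magnetic coefficient is the same in both fluids and drops out of `αp - αm`, leaving the
    -- inertial jump `l²[ρ]ψ'`.
    · rw [e3] at e4
      linear_combination -e4 - l ^ 2 * ρm * e5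
  · intro h
    have e5 := h.jump_deriv
    refine ⟨?_, (contDiff_infty.1 hp 4).contDiffOn.congr em,
      (contDiff_infty.1 hq 4).contDiffOn.congr ep, ?_, (j1 0).2 ?_, (j2 0).2 ?_,
      ⟨_, (j3 _).2 rfl, (j4 _).2 ?_⟩, ?_, ?_, ?_, ?_⟩
    · have h1 : ContinuousOn ψ (Icc (-1) 0) := cp.continuousOn.congr hψp
      have h2 : ContinuousOn ψ (Icc 0 1) := cq.continuousOn.congr hψq
      have := h1.union_of_isClosed h2 isClosed_Icc isClosed_Icc
      rwa [Icc_union_Icc_eq_Icc (by norm_num) (by norm_num)] at this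
    · rintro x (hx | hx)
      · rw [twoPhase_of_neg hx, twoPhase_of_neg hx, em hx, dm 2 hx, dm 4 hx, ← sq_abs ξ]
        linear_combination -hop x
      · rw [twoPhase_of_pos hx, twoPhase_of_pos hx, ep hx, dp 2 hx, dp 4 hx, ← sq_abs ξ]
        linear_combination -hoq x
    · linarith
    · linear_combination -h.jump_two
    · linear_combination -h.jump_three - l ^ 2 * ρm * e5
    · rw [hψp (by simp), h.left]
    · rw [hψq (by simp), h.right]
    · rw [← h.deriv_left]; exact tl
    · rw [← h.deriv_right]; exact tr

/-- The gluing of two functions along the interface. -/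
def glue (p q : ℝ → ℝ) (x : ℝ) : ℝ := if x ≤ 0 then p x else q x

theorem glue_eqOn_lower (p q : ℝ → ℝ) : EqOn (glue p q) p (Icc (-1) 0) := fun _ hx => if_pos hx.2

theorem glue_eqOn_upper {p q : ℝ → ℝ} (h : p 0 = q 0) : EqOn (glue p q) q (Icc 0 1) := by
  intro x hx
  rcases hx.1.eq_or_lt with rfl | h0
  · simp [glue, h]
  · exact if_neg (not_le.2 h0)

theorem IsNormalMode.exists_isResponse {g ρp ρm μp μm B ξ l : ℝ} {ψ : ℝ → ℝ}
    (hρm : 0 < ρm) (hρp : 0 < ρp) (hμp : 0 < μp) (hμm : 0 < μm) (hl : 0 < l)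
    (h : IsNormalMode g ρp ρm μp μm B ξ l ψ) :
    ∃ p q, EqOn ψ p (Icc (-1) 0) ∧ EqOn ψ q (Icc 0 1) ∧
      IsResponse (l ^ 2 * ρm + |B| ^ 2 * |ξ| ^ 2) (l ^ 2 * ρp + |B| ^ 2 * |ξ| ^ 2) (l * μm)
        (l * μp) |ξ| (g * (ρp - ρm) * |ξ| ^ 2 * ψ 0) p q := by
  obtain ⟨p, hp, hop, hep⟩ := exists_extension_of_ode (k := |ξ|)
    (show 0 < l ^ 2 * ρm + |B| ^ 2 * |ξ| ^ 2 by positivity) (show 0 < l * μm by positivity)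
    h.contDiffOn_lower (fun x hx => by
      have := h.ode x (Or.inl hx)
      rw [twoPhase_of_neg hx, twoPhase_of_neg hx, ← sq_abs ξ] at this
      linear_combination -this)
  obtain ⟨q, hq, hoq, heq⟩ := exists_extension_of_ode (k := |ξ|)
    (show 0 < l ^ 2 * ρp + |B| ^ 2 * |ξ| ^ 2 by positivity) (show 0 < l * μp by positivity)
    h.contDiffOn_upper (fun x hx => by
      have := h.ode x (Or.inr hx)
      rw [twoPhase_of_pos hx, twoPhase_of_pos hx, ← sq_abs ξ] at this
      linear_combination -this)
  have hψp : EqOn ψ p (Icc (-1) 0) := hep.of_subset_closure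
    (h.continuousOn.mono (Icc_subset_Icc_right (by norm_num))) hp.continuous.continuousOn
    Ioo_subset_Icc_self (by rw [closure_Ioo (by norm_num)])
  have hψq : EqOn ψ q (Icc 0 1) := heq.of_subset_closure
    (h.continuousOn.mono (Icc_subset_Icc_left (by norm_num))) hq.continuous.continuousOn
    Ioo_subset_Icc_self (by rw [closure_Ioo (by norm_num)])
  exact ⟨p, q, hψp, hψq, (isNormalMode_iff_isResponse hp hq hop hoq hψp hψq).1 h⟩

/-! ### Modes and trial functions against the stability inequality on `H¹₀`. -/

theorem integral_Ioo_of_eqOn {f fm fp : ℝ → ℝ} (hm : EqOn f fm (Ioo (-1) 0))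
    (hp : EqOn f fp (Ioo 0 1)) (cm : Continuous fm) (cp : Continuous fp) :
    ∫ x in Ioo (-1 : ℝ) 1, f x = (∫ x in (-1 : ℝ)..0, fm x) + ∫ x in (0 : ℝ)..1, fp x := by
  have im : IntervalIntegrable f volume (-1) 0 := by
    rw [intervalIntegrable_iff_integrableOn_Ioo_of_le (by norm_num)]
    exact (cm.integrableOn_Icc.mono_set Ioo_subset_Icc_self).congr_fun hm.symm measurableSet_Ioo
  have ip : IntervalIntegrable f volume 0 1 := by
    rw [intervalIntegrable_iff_integrableOn_Ioo_of_le (by norm_num)]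
    exact (cp.integrableOn_Icc.mono_set Ioo_subset_Icc_self).congr_fun hp.symm measurableSet_Ioo
  rw [integral_Ioo_eq _ (by norm_num), ← intervalIntegral.integral_add_adjacent_intervals im ip,
    ← integral_Ioo_eq _ (by norm_num), ← integral_Ioo_eq _ (by norm_num),
    ← integral_Ioo_eq _ (by norm_num), ← integral_Ioo_eq _ (by norm_num),
    setIntegral_congr_fun measurableSet_Ioo hm, setIntegral_congr_fun measurableSet_Ioo hp]

/-- Integration by parts on each side: the wall terms vanish and the interface terms cancel because
`p 0 = q 0`. -/
theorem isH10_of_eqOn {p q ψ : ℝ → ℝ} (h : Admissible p q) (hc : ContinuousOn ψ (Icc (-1) 1))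
    (hψp : EqOn ψ p (Icc (-1) 0)) (hψq : EqOn ψ q (Icc 0 1)) : IsH10 ψ (deriv ψ) := by
  have em : EqOn ψ p (Ioo (-1) 0) := hψp.mono Ioo_subset_Icc_self
  have ep : EqOn ψ q (Ioo 0 1) := hψq.mono Ioo_subset_Icc_self
  have dm : EqOn (deriv ψ) (deriv p) (Ioo (-1) 0) := by
    simpa using iteratedDeriv_eqOn isOpen_Ioo em 1
  have dp : EqOn (deriv ψ) (deriv q) (Ioo 0 1) := by
    simpa using iteratedDeriv_eqOn isOpen_Ioo ep 1
  have cp := h.smooth_lower.continuous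
  have cq := h.smooth_upper.continuous
  have cp1 := continuous_deriv_of_smooth h.smooth_lower
  have cq1 := continuous_deriv_of_smooth h.smooth_upper
  refine ⟨hc, ?_, ?_, ?_, ?_⟩
  · obtain ⟨C, hC⟩ := (isCompact_Icc (a := (-1 : ℝ)) (b := 0)).exists_bound_of_continuousOn
      cp1.continuousOn
    obtain ⟨D, hD⟩ := (isCompact_Icc (a := (0 : ℝ)) (b := 1)).exists_bound_of_continuousOn
      cq1.continuousOn
    have : IsFiniteMeasure (volume.restrict (Ioo (-1 : ℝ) 1)) := by constructor; simp
    refine MemLp.of_bound (measurable_deriv ψ).aestronglyMeasurable (max C D) ?_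
    have h0 : ∀ᵐ x : ℝ, x ≠ 0 := by
      simp [ae_iff]
    filter_upwards [ae_restrict_mem measurableSet_Ioo, ae_restrict_of_ae h0] with x hx hx0
    rcases lt_or_gt_of_ne hx0 with hlt | hgt
    · rw [dm ⟨hx.1, hlt⟩]
      exact (hC x ⟨hx.1.le, hlt.le⟩).trans (le_max_left _ _)
    · rw [dp ⟨hgt, hx.2⟩]
      exact (hD x ⟨hgt.le, hx.2.le⟩).trans (le_max_right _ _)
  · intro η h1 _ _
    have ce := h1.continuous
    have ce1 := continuous_deriv_of_smooth h1
    rw [integral_Ioo_of_eqOn (fm := fun x => p x * deriv η x) (fp := fun x => q x * deriv η x)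
      (fun x hx => by simp only [em hx]) (fun x hx => by simp only [ep hx]) (by fun_prop)
      (by fun_prop), integral_Ioo_of_eqOn (fm := fun x => deriv p x * η x)
      (fp := fun x => deriv q x * η x) (fun x hx => by simp only [dm hx])
      (fun x hx => by simp only [dp hx]) (by fun_prop) (by fun_prop),
      intervalIntegral.integral_mul_deriv_eq_deriv_mul
        (fun x _ => hasDerivAt_self h.smooth_lower x) (fun x _ => hasDerivAt_self h1 x)
        (cp1.intervalIntegrable _ _) (ce1.intervalIntegrable _ _),
      intervalIntegral.integral_mul_deriv_eq_deriv_mul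
        (fun x _ => hasDerivAt_self h.smooth_upper x) (fun x _ => hasDerivAt_self h1 x)
        (cq1.intervalIntegrable _ _) (ce1.intervalIntegrable _ _), h.left, h.right, h.jump]
    ring
  · rw [hψp (by simp), h.left]
  · rw [hψq (by simp), h.right]

theorem sobolev_add (a b c k : ℝ) (p q : ℝ → ℝ) :
    sobolev (a + c) (b + c) k p q = sobolev a b k p q + c * sobolev 1 1 k p q := by
  unfold sobolev; ring

theorem sobolev_one_eq {p q ψ : ℝ → ℝ} (hp : ContDiff ℝ ∞ p) (hq : ContDiff ℝ ∞ q)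
    (hψp : EqOn ψ p (Icc (-1) 0)) (hψq : EqOn ψ q (Icc 0 1)) (k : ℝ) :
    sobolev 1 1 k p q = k ^ 2 * (∫ x in Ioo (-1 : ℝ) 1, ψ x ^ 2) +
      ∫ x in Ioo (-1 : ℝ) 1, deriv ψ x ^ 2 := by
  have em : EqOn ψ p (Ioo (-1) 0) := hψp.mono Ioo_subset_Icc_self
  have ep : EqOn ψ q (Ioo 0 1) := hψq.mono Ioo_subset_Icc_self
  have dm : EqOn (deriv ψ) (deriv p) (Ioo (-1) 0) := by
    simpa using iteratedDeriv_eqOn isOpen_Ioo em 1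
  have dp : EqOn (deriv ψ) (deriv q) (Ioo 0 1) := by
    simpa using iteratedDeriv_eqOn isOpen_Ioo ep 1
  have key : ∀ {F : ℝ → ℝ} {a b : ℝ}, ContDiff ℝ ∞ F →
      ∫ x in a..b, (k ^ 2 * F x ^ 2 + deriv F x ^ 2) =
        k ^ 2 * (∫ x in a..b, F x ^ 2) + ∫ x in a..b, deriv F x ^ 2 := by
    intro F a b hF
    have c0 := hF.continuous
    have c1 := continuous_deriv_of_smooth hF
    rw [intervalIntegral.integral_add, intervalIntegral.integral_const_mul]
    · exact Continuous.intervalIntegrable (by fun_prop) _ _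
    · exact Continuous.intervalIntegrable (by fun_prop) _ _
  have cp := hp.continuous
  have cq := hq.continuous
  have cp1 := continuous_deriv_of_smooth hp
  have cq1 := continuous_deriv_of_smooth hq
  rw [sobolev, key hp, key hq,
    integral_Ioo_of_eqOn (f := fun x => ψ x ^ 2) (fm := fun x => p x ^ 2)
      (fp := fun x => q x ^ 2) (fun x hx => by simp only [em hx]) (fun x hx => by simp only [ep hx])
      (by fun_prop) (by fun_prop),
    integral_Ioo_of_eqOn (f := fun x => deriv ψ x ^ 2) (fm := fun x => deriv p x ^ 2)
      (fp := fun x => deriv q x ^ 2) (fun x hx => by simp only [dm hx])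
      (fun x hx => by simp only [dp hx]) (by fun_prop) (by fun_prop)]
  ring

/-- A growing normal mode violates the stability inequality of the magnetic energy. -/
theorem IsNormalMode.exists_isH10_lt {g ρp ρm μp μm B ξ l : ℝ} {ψ : ℝ → ℝ}
    (hρm : 0 < ρm) (hρp : 0 < ρp) (hμp : 0 < μp) (hμm : 0 < μm) (hl : 0 < l)
    (h : IsNormalMode g ρp ρm μp μm B ξ l ψ) (hn : Nontriv ψ) :
    ∃ φ, IsH10 ψ φ ∧ |B| ^ 2 * (∫ x in Ioo (-1 : ℝ) 1, φ x ^ 2) +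
      |B| ^ 2 * |ξ| ^ 2 * (∫ x in Ioo (-1 : ℝ) 1, ψ x ^ 2) < g * (ρp - ρm) * ψ 0 ^ 2 := by
  obtain ⟨p, q, hψp, hψq, hR⟩ := h.exists_isResponse hρm hρp hμp hμm hl
  have hH := isH10_of_eqOn hR.toAdmissible h.continuousOn hψp hψq
  refine ⟨deriv ψ, hH, ?_⟩
  by_contra! hle
  have hE := hR.energy_eq hR.toAdmissible
  have hS := sobolev_le_energy (αm := l ^ 2 * ρm + |B| ^ 2 * |ξ| ^ 2)
    (αp := l ^ 2 * ρp + |B| ^ 2 * |ξ| ^ 2) (νm := l * μm) (νp := l * μp) |ξ|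
    hR.smooth_lower hR.smooth_upper (by positivity) (by positivity)
  rw [hE, sobolev_add, sobolev_one_eq hR.smooth_lower hR.smooth_upper hψp hψq, ← hψq (by simp)]
    at hS
  -- The force and the magnetic weight both carry the factor `|ξ|²`; after cancellation only the
  -- inertial energy is left, and it is not positive.
  have hle' := mul_le_mul_of_nonneg_left hle (sq_nonneg |ξ|)
  have h0 : sobolev (l ^ 2 * ρm) (l ^ 2 * ρp) |ξ| p q ≤ 0 := by linarith
  obtain ⟨h1, h2⟩ := eqOn_zero_of_sobolev_le hR.smooth_lower hR.smooth_upper (by positivity)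
    (by positivity) h0
  -- At `ξ = 0` the inertial energy sees only `ψ'`; hence `ψ = 0` is recovered from `ψ' = 0` and the
  -- left wall.
  have hP : ∫ x in Ioo (-1 : ℝ) 1, deriv ψ x ^ 2 ≤ 0 := by
    have h3 := sobolev_one_eq hR.smooth_lower hR.smooth_upper hψp hψq |ξ|
    have h4 : sobolev 1 1 |ξ| p q = 0 := by
      rw [sobolev, intervalIntegral.integral_congr (g := fun _ => 0) (fun x hx => h1 x (by
        rwa [uIcc_of_le (by norm_num)] at hx)), intervalIntegral.integral_congr (a := 0) (b := 1)
        (g := fun _ => 0) (fun x hx => h2 x (by rwa [uIcc_of_le (by norm_num)] at hx))]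
      simp
    have h5 : 0 ≤ |ξ| ^ 2 * ∫ x in Ioo (-1 : ℝ) 1, ψ x ^ 2 :=
      mul_nonneg (sq_nonneg _) (integral_nonneg fun x => sq_nonneg _)
    linarith
  obtain ⟨x, hx, hx0⟩ := hn
  have h6 := hH.sq_sub_le (a := -1) (b := x) (by simp) (Ioo_subset_Icc_self hx) hx.1.le
  rw [hH.left, sub_zero] at h6
  have h7 := mul_nonpos_of_nonneg_of_nonpos (show 0 ≤ x - -1 by linarith [hx.1]) hP
  exact hx0 (pow_eq_zero_iff two_ne_zero |>.1 (le_antisymm (h6.trans h7) (sq_nonneg _)))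

theorem IsTest.admissible {χ : ℝ → ℝ} (h : IsTest χ) : Admissible χ χ := by
  obtain ⟨r, hr0, hr1, hr⟩ := h.exists_radius
  obtain ⟨s, hs0, hs1, hs⟩ := h.deriv.exists_radius
  exact ⟨h.contDiff, h.contDiff, hr _ (by simpa using hr1.le), hs _ (by simpa using hs1.le),
    hr _ (by simpa using hr1.le), hs _ (by simpa using hs1.le), rfl, rfl⟩

/-- Below the critical frequency some test function violates the stability inequality. -/
theorem exists_isTest_of_lt_criticalFreqH {g j B k : ℝ} (hgj : 0 < g * j) (hB : B ≠ 0)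
    (hk : 0 < k) (hlt : k < criticalFreqH g j B) :
    ∃ χ, IsTest χ ∧ sobolev (|B| ^ 2 * k ^ 2) (|B| ^ 2 * k ^ 2) k χ χ <
      g * j * k ^ 2 * χ 0 ^ 2 := by
  have hB2 : 0 < |B| ^ 2 := by positivity
  rw [criticalFreqH, Real.lt_sqrt hk.le] at hlt
  have hne : {q : ℝ | ∃ ψ φ : ℝ → ℝ, IsH10 ψ φ ∧ Nontriv ψ ∧
      q = (g * j * ψ 0 ^ 2 - |B| ^ 2 * ∫ x in Ioo (-1 : ℝ) 1, φ x ^ 2) /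
        (|B| ^ 2 * ∫ x in Ioo (-1 : ℝ) 1, ψ x ^ 2)}.Nonempty := by
    -- The supremum of the empty set is `0` by convention, which cannot exceed `k² > 0`.
    by_contra hemp
    rw [not_nonempty_iff_eq_empty.1 hemp, Real.sSup_empty] at hlt
    nlinarith
  obtain ⟨_, ⟨ψ, φ, h, hn, rfl⟩, hq⟩ := exists_lt_of_lt_csSup hne hlt
  have hS := h.integral_sq_pos hn
  rw [lt_div_iff₀ (mul_pos hB2 hS)] at hq
  obtain ⟨χ, hχ, hχlt⟩ := h.exists_isTest_lt (a := g * j / |B| ^ 2) (k := k) (by positivity) (by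
    rw [div_mul_eq_mul_div, lt_div_iff₀ hB2]
    linarith)
  refine ⟨χ, hχ, ?_⟩
  have e := sobolev_add 0 0 (|B| ^ 2 * k ^ 2) k χ χ
  rw [zero_add, sobolev_one_eq hχ.contDiff hχ.contDiff (eqOn_refl _ _) (eqOn_refl _ _)] at e
  rw [e]
  rw [div_mul_eq_mul_div, lt_div_iff₀ hB2] at hχlt
  have := mul_lt_mul_of_pos_left hχlt (show 0 < k ^ 2 by positivity)
  have h0 : sobolev 0 0 k χ χ = 0 := by simp [sobolev]
  rw [h0]
  linarith

end

end RayleighTaylorMHD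

theorem theorem2p2 (g ρp ρm μp μm B : ℝ) (hg : 0 < g) (hρm : 0 < ρm) (hρ : ρm < ρp)
    (hμp : 0 < μp) (hμm : 0 < μm) (hB : B ≠ 0) :
    (RayleighTaylorMHD.criticalB g (ρp - ρm) ≤ |B| →
      ∀ ξ : ℝ, ¬ ∃ (lam : ℝ) (ψ : ℝ → ℝ), 0 < lam ∧ RayleighTaylorMHD.Nontriv ψ ∧
        RayleighTaylorMHD.IsNormalMode g ρp ρm μp μm B ξ lam ψ) ∧
    (|B| < RayleighTaylorMHD.criticalB g (ρp - ρm) →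
      ∀ ξ : ℝ, RayleighTaylorMHD.criticalFreqH g (ρp - ρm) B ≤ |ξ| →
        ¬ ∃ (lam : ℝ) (ψ : ℝ → ℝ), 0 < lam ∧ RayleighTaylorMHD.Nontriv ψ ∧
          RayleighTaylorMHD.IsNormalMode g ρp ρm μp μm B ξ lam ψ) ∧
    (|B| < RayleighTaylorMHD.criticalB g (ρp - ρm) →
      ∃ (lam : ℝ → ℝ) (ψ : ℝ → ℝ → ℝ),
        ∀ ξ : ℝ, 0 < |ξ| → |ξ| < RayleighTaylorMHD.criticalFreqH g (ρp - ρm) B →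
          0 < lam ξ ∧
          RayleighTaylorMHD.IsNormalMode g ρp ρm μp μm B ξ (lam ξ) (ψ ξ) ∧
          lam (-ξ) = lam ξ ∧ ψ (-ξ) = ψ ξ ∧
          ContDiffOn ℝ ∞ (ψ ξ) (Set.Ioo (-1) 0) ∧ ContDiffOn ℝ ∞ (ψ ξ) (Set.Ioo 0 1) ∧
          ψ ξ 0 ≠ 0) := by
  have hρp : 0 < ρp := hρm.trans hρ
  have hgj : 0 < g * (ρp - ρm) := mul_pos hg (sub_pos.2 hρ)
  have hB2 : 0 < |B| ^ 2 := by positivity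
  refine ⟨?_, ?_, fun _ => ?_⟩
  · rintro hBc ξ ⟨l, ψ, hl, hn, h⟩
    obtain ⟨φ, hφ, hlt⟩ := h.exists_isH10_lt hρm hρp hμp hμm hl hn
    have h1 := hφ.le_criticalB hn hgj.le
    have h2 : RayleighTaylorMHD.criticalB g (ρp - ρm) ^ 2 ≤ |B| ^ 2 :=
      pow_le_pow_left₀ (Real.sqrt_nonneg _) hBc 2
    have h3 := mul_le_mul_of_nonneg_right h2
      (show 0 ≤ ∫ x in Ioo (-1 : ℝ) 1, φ x ^ 2 from integral_nonneg fun x => sq_nonneg _)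
    have h4 := mul_nonneg (show 0 ≤ |B| ^ 2 * |ξ| ^ 2 by positivity)
      (show 0 ≤ ∫ x in Ioo (-1 : ℝ) 1, ψ x ^ 2 from integral_nonneg fun x => sq_nonneg _)
    linarith
  · rintro - ξ hξ ⟨l, ψ, hl, hn, h⟩
    obtain ⟨φ, hφ, hlt⟩ := h.exists_isH10_lt hρm hρp hμp hμm hl hn
    have h1 := hφ.le_criticalFreqH hn hgj.le hB
    have h2 : RayleighTaylorMHD.criticalFreqH g (ρp - ρm) B ^ 2 ≤ |ξ| ^ 2 :=
      pow_le_pow_left₀ (Real.sqrt_nonneg _) hξ 2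
    have h3 := mul_le_mul_of_nonneg_right h2 (mul_nonneg hB2.le
      (show 0 ≤ ∫ x in Ioo (-1 : ℝ) 1, ψ x ^ 2 from integral_nonneg fun x => sq_nonneg _))
    linarith
  -- Choosing the mode as a function of `k = |ξ|` makes it even in `ξ`.
  · have hex : ∀ k : ℝ, ∃ (l : ℝ) (p q : ℝ → ℝ), 0 < k →
        k < RayleighTaylorMHD.criticalFreqH g (ρp - ρm) B → 0 < l ∧
        RayleighTaylorMHD.IsResponse (l ^ 2 * ρm + |B| ^ 2 * k ^ 2) (l ^ 2 * ρp + |B| ^ 2 * k ^ 2)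
          (l * μm) (l * μp) k 1 p q ∧ g * (ρp - ρm) * k ^ 2 * q 0 = 1 := by
      intro k
      by_cases hk : 0 < k ∧ k < RayleighTaylorMHD.criticalFreqH g (ρp - ρm) B
      · obtain ⟨χ, hχ, hlt⟩ :=
          RayleighTaylorMHD.exists_isTest_of_lt_criticalFreqH hgj hB hk.1 hk.2
        obtain ⟨l, hl, p, q, h⟩ := RayleighTaylorMHD.exists_growth_rate hρm hρp hμm hμp
          (mul_pos hB2 (pow_pos hk.1 2)) hk.1 (mul_pos hgj (pow_pos hk.1 2)) hχ.admissible hlt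
        exact ⟨l, p, q, fun _ _ => ⟨hl, h⟩⟩
      · exact ⟨0, 0, 0, fun h1 h2 => absurd ⟨h1, h2⟩ hk⟩
    choose L p q hLpq using hex
    refine ⟨fun ξ => L |ξ|, fun ξ => RayleighTaylorMHD.glue (p |ξ|) (q |ξ|), fun ξ h0 h1 => ?_⟩
    obtain ⟨hl, hR, hq⟩ := hLpq |ξ| h0 h1
    have em := RayleighTaylorMHD.glue_eqOn_lower (p |ξ|) (q |ξ|)
    have ep := RayleighTaylorMHD.glue_eqOn_upper hR.jump
    have hval : RayleighTaylorMHD.glue (p |ξ|) (q |ξ|) 0 = q |ξ| 0 := ep (by simp)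
    refine ⟨hl, ?_, by simp, by simp,
      hR.smooth_lower.contDiffOn.congr (em.mono Ioo_subset_Icc_self),
      hR.smooth_upper.contDiffOn.congr (ep.mono Ioo_subset_Icc_self), ?_⟩
    -- By `hq` the self-induced force `g[ρ]|ξ|²ψ(0)` equals the unit force that was applied.
    · rw [RayleighTaylorMHD.isNormalMode_iff_isResponse hR.smooth_lower hR.smooth_upper
        hR.ode_lower hR.ode_upper em ep, hval, hq]
      exact hR
    · intro hz
      rw [show q |ξ| 0 = 0 from hval.symm.trans hz, mul_zero] at hq
      exact zero_ne_one hq
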